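/- Let $G$ be a finite connected plane graph (loops and multiple edges allowed, at least one edge) without leaves, i.e. without vertices of degree one. Let $\mathcal F$ be its set of bounded faces, $f_G=|\mathcal F|$, and let $e_G$ be its number of edges. For $S\subseteq\mathcal F$ let $e_S$ be the number of edges lying on the boundary of some face in $S$, and $f_S=|S|$; $S$ is called \emph{contractible} if $e_S-3f_S\le 0$. Assume that $e_G=3f_G$ and that no nonempty proper subset of $\mathcal F$ is contractible. An \emph{edge-injective function} $\varphi$ assigns to every $F\in\mathcal F$ a set $\varphi(F)$ of three edges on the boundary of $F$ such that $\varphi(F)\cap\varphi(F')=\emptyset$ for $F\ne F'$. Let $\Phi$ be the set of all edge-injective functions. The \emph{modified dual} $G^\star$ has vertex set $\mathcal F$; every edge of $G$ shared by two bounded faces gives an edge between them, and every edge of $G$ belonging to only one bounded face gives a loop there. Every $\varphi\in\Phi$ gives an orientation $G^\star_\varphi$ of $G^\star$ with in-degree three everywhere: $e$ is directed towards $F$ if $e\in\varphi(F)$. Draw $G^\star$ in the plane in the usual way, with the loops coming from edges on the unbounded face of $G$ drawn as small loops reaching into that face; apart from the regions enclosed by these small loops, the bounded faces of $G^\star$ correspond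 to the vertices of $G$ that are not on the unbounded face. A \emph{directed face cycle} of $G^\star_\varphi$ is the boundary walk of such a bounded face of $G^\star$, if it is directed in $G^\star_\varphi$ (the direction of a loop does not matter). Let $G_\Phi$ be the graph with vertex set $\Phi$ in which $\varphi\neq\varphi'$ are adjacent if $G^\star_\varphi$ and $G^\star_{\varphi'}$ differ exactly by reversing the arrows on a directed face cycle. Simple directed cycles are understood to have length at least two (loops are disregarded). Then: 1. For all $\varphi,\varphi'\in\Phi$, $G^\star_\varphi$ can be obtained from $G^\star_{\varphi'}$ by successively reversing simple directed cycles. 2. The graph $G_\Phi$ is connected (in particular $\Phi\neq\emptyset$); that is, any two elements of $\Phi$ are related by successively reversing directed face cycles. 3. For every $\varphi\in\Phi$, $|\Phi|=m+1$, where $m$ is the number of directed cycles of $G^\star_\varphi$; here a directed cycle is a nonempty edge set that is a union of pairwise edge-disjoint simple directed cycles. In particular $m$ does not depend on $\varphi$. -/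

import Mathlib

/-- A finite connected multigraph (loops and multiple edges are allowed, there is at least one
edge) embedded in the oriented plane, given by its rotation system. `D` is the type of darts, i.e.
of edges with a chosen direction; a dart leaves its tail vertex. `rev d` is the same edge with the
opposite direction, and `next d` is the dart that follows `d` in counterclockwise order around the
tail of `d`. Vertices, edges and faces are the cycles of `next`, `rev` and `next⁻¹ * rev`: walking
along `d` with a face on the left-hand side, one continues with `next⁻¹ (rev d)`.
Euler's formula `v - e + f = 2` says that the surface is the sphere, and the choice of an
unbounded face makes it the plane. -/
structure PlaneGraph (D : Type*) where
  next : Equiv.Perm D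
  rev : Equiv.Perm D
  rev_rev : ∀ d, rev (rev d) = d
  rev_ne : ∀ d, rev d ≠ d
  connected : ∀ a b : D, Relation.ReflTransGen (fun x y => y = next x ∨ y = rev x) a b
  euler : Nat.card (Quotient (Equiv.Perm.SameCycle.setoid next)) +
      Nat.card (Quotient (Equiv.Perm.SameCycle.setoid (next⁻¹ * rev))) =
    Nat.card (Quotient (Equiv.Perm.SameCycle.setoid rev)) + 2
  /-- the unbounded face -/
  outer : Quotient (Equiv.Perm.SameCycle.setoid (next⁻¹ * rev))

namespace PlaneGraph

variable {D : Type*} (G : PlaneGraph D)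

/-- The vertices of the graph. -/
abbrev Vertex : Type _ := Quotient (Equiv.Perm.SameCycle.setoid G.next)

/-- The edges of the graph. -/
abbrev Edge : Type _ := Quotient (Equiv.Perm.SameCycle.setoid G.rev)

/-- All faces of the plane graph, including the unbounded one. -/
abbrev Face : Type _ := Quotient (Equiv.Perm.SameCycle.setoid (G.next⁻¹ * G.rev))

/-- The vertex from which a dart leaves. -/
def tail (d : D) : G.Vertex := Quotient.mk _ d

/-- The edge underlying a dart. -/
def edge (d : D) : G.Edge := Quotient.mk _ d

/-- The face to the left of a dart. -/
def left (d : D) : G.Face := Quotient.mk _ d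

/-- The face to the right of a dart. -/
def right (d : D) : G.Face := G.left (G.rev d)

/-- The bounded faces. -/
abbrev BoundedFace : Type _ := {F : G.Face // F ≠ G.outer}

/-- There are no leaves: no vertex has degree one. -/
def NoLeaves : Prop := ∀ d : D, G.next d ≠ d

/-- The edge `e` lies on the boundary of the face `F`. -/
def OnFace (e : G.Edge) (F : G.Face) : Prop := ∃ d : D, G.edge d = e ∧ G.left d = F

/-- The edges of the subgraph formed by the faces in `S` with their bounding vertices and edges. -/
def edgesOf (S : Set G.BoundedFace) : Set G.Edge := {e | ∃ F ∈ S, G.OnFace e F.1}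

/-- A set `S` of bounded faces is contractible if `e_S - 3 f_S ≤ 0`. -/
def Contractible (S : Set G.BoundedFace) : Prop :=
  ((G.edgesOf S).ncard : ℤ) - 3 * (S.ncard : ℤ) ≤ 0

/-- No proper (nonempty) subset of the set of bounded faces is contractible. -/
def NoProperContractible : Prop :=
  ∀ S : Set G.BoundedFace, S.Nonempty → S ≠ Set.univ → ¬ G.Contractible S

/-- The edge-injective functions: each bounded face gets a triple of edges on its boundary, and
different faces get disjoint triples. -/
abbrev EdgeInjective : Type _ :=
  {φ : G.BoundedFace → Finset G.Edge //
    (∀ F, (φ F).card = 3) ∧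
    (∀ F, ∀ e ∈ φ F, G.OnFace e F.1) ∧
    (∀ F F', F ≠ F' → Disjoint (φ F) (φ F'))}

/-- Incidence in the modified dual graph `G*`: its vertices are the bounded faces, an edge shared by
two bounded faces joins them, and an edge that belongs to only one bounded face is a loop there. -/
def DualJoins (e : G.Edge) (F F' : G.BoundedFace) : Prop :=
  (F ≠ F' ∧ G.OnFace e F.1 ∧ G.OnFace e F'.1) ∨
  (F = F' ∧ G.OnFace e F.1 ∧ ∀ F'' : G.BoundedFace, G.OnFace e F''.1 → F'' = F)

variable {G}

/-- In the orientation `G*_φ` of the modified dual, the edge `e` is directed from `F` to `F'`. -/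
def Arrow (φ : G.EdgeInjective) (e : G.Edge) (F F' : G.BoundedFace) : Prop :=
  G.DualJoins e F F' ∧ e ∈ φ.1 F'

/-- `C` is the edge set of a simple directed cycle of `G*_φ` of length at least two (reversing a
loop has no effect, so that loops are disregarded). -/
def IsDirectedCycle (φ : G.EdgeInjective) (C : Set G.Edge) : Prop :=
  ∃ (n : ℕ) (F : Fin (n + 2) → G.BoundedFace) (e : Fin (n + 2) → G.Edge),
    Function.Injective F ∧ (∀ i, Arrow φ (e i) (F i) (F (i + 1))) ∧ C = Set.range e

/-- `C` is the edge set of a nonempty union of pairwise edge-disjoint simple directed cycles of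
`G*_φ`; this includes the simple directed cycles themselves. -/
def IsGenDirectedCycle (φ : G.EdgeInjective) (C : Set G.Edge) : Prop :=
  ∃ 𝒞 : Set (Set G.Edge), 𝒞.Nonempty ∧ (∀ c ∈ 𝒞, IsDirectedCycle φ c) ∧
    𝒞.PairwiseDisjoint id ∧ C = ⋃₀ 𝒞

/-- `G*_ψ` arises from `G*_φ` by reversing exactly the arrows on the edges in `C`. -/
def Reverses (C : Set G.Edge) (φ ψ : G.EdgeInjective) : Prop :=
  (∀ e ∉ C, ∀ F F', Arrow φ e F F' ↔ Arrow ψ e F F') ∧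
  (∀ e ∈ C, ∀ F F', Arrow φ e F F' ↔ Arrow ψ e F' F)

/-- The vertex `v` is not on the unbounded face. These vertices correspond to the bounded faces of
the plane graph `G*` (apart from those enclosed by the small loops at the outer edges). -/
def Interior (v : G.Vertex) : Prop := ∀ d : D, G.tail d = v → G.left d ≠ G.outer

/-- `e` is directed from the face `F` to the face `F'` in `G*_φ`, for faces `F`, `F'` of the plane
graph, which then are bounded. -/
def FaceArrow (φ : G.EdgeInjective) (e : G.Edge) (F F' : G.Face) : Prop :=
  ∃ (hF : F ≠ G.outer) (hF' : F' ≠ G.outer), Arrow φ e ⟨F, hF⟩ ⟨F', hF'⟩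

/-- `v` is an interior vertex and the boundary walk of the face of `G*` around `v` is directed in
`G*_φ`. Going counterclockwise around `v`, this walk crosses each edge `d` leaving `v` from its
right to its left; it is directed if all of its arrows point in that sense, or all in the opposite
sense. -/
def IsDirectedFaceCycle (φ : G.EdgeInjective) (v : G.Vertex) : Prop :=
  Interior v ∧
    ((∀ d : D, G.tail d = v → FaceArrow φ (G.edge d) (G.right d) (G.left d)) ∨
     (∀ d : D, G.tail d = v → FaceArrow φ (G.edge d) (G.left d) (G.right d)))

/-- The edges on the boundary of the face of `G*` around the vertex `v`. -/
def faceCycle (v : G.Vertex) : Set G.Edge := {e | ∃ d : D, G.tail d = v ∧ G.edge d = e}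

variable (G)

/-- The graph `G_Φ` on the set `Φ` of edge-injective functions: two different ones are adjacent if
their orientations of `G*` differ by reversing a directed face cycle. -/
def flipGraph : SimpleGraph G.EdgeInjective :=
  SimpleGraph.fromRel fun φ ψ =>
    ∃ v : G.Vertex, IsDirectedFaceCycle φ v ∧ Reverses (faceCycle v) φ ψ

end PlaneGraph

/-! Since $e_G=3f_G$, the triples of an edge-injective function use up all edges
(`EdgeInjective.exists_mem`), so $\Phi$ is the set of orientations of $G^\star$ with all in-degrees
three. Two of them differ on a set of non-loops that has equal in- and out-degree at each face, and
reversing any such `Balanced` set in $\varphi$ gives an element of $\Phi$. Balanced sets are exactly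
the disjoint unions of simple directed cycles (`Balanced.exists_eq_sUnion`). Peeling cycles off the
difference gives claim 1; the bijection $\psi\mapsto$ `diff φ ψ` gives claim 3.

Non-emptiness of $\Phi$ is Hall's theorem with three copies of each face. The whole set $\mathcal F$
satisfies Hall's condition because every edge lies on a bounded face: an edge with the unbounded
face on both sides would be a bridge splitting $\mathcal F$ into two non-contractible parts, which
need too many edges.

For connectedness, the difference of two orientations has zero sum around every face of $G$, so on
the sphere it is the coboundary of an integral height function on the vertices, zero on the
unbounded face (`exists_isPotential`). If the height is positive somewhere, some vertex of maximal
height carries a directed face cycle (`IsPotential.exists_sink`); otherwise arrows could be followed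
along a closed walk of $G$, and the faces of maximal winding number would form a contractible proper
subset (`not_injective_walk`). Reversing the face cycle lowers the height there by one. If the
height is negative somewhere, the two orientations swap roles. The sum of absolute heights drops to
zero, where the orientations agree. -/

namespace PlaneGraph

/-! ### Incidence identities for darts and propagation of invariants. -/

section Basics

variable {D : Type*} (G : PlaneGraph D)

theorem tail_next (d : D) : G.tail (G.next d) = G.tail d :=
  Quotient.sound (Equiv.Perm.SameCycle.symm ⟨1, by simp⟩)

theorem edge_rev (d : D) : G.edge (G.rev d) = G.edge d :=
  Quotient.sound (Equiv.Perm.SameCycle.symm ⟨1, by simp⟩)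

theorem left_face (d : D) : G.left (G.next⁻¹ (G.rev d)) = G.left d :=
  Quotient.sound (Equiv.Perm.SameCycle.symm ⟨1, by simp⟩)

theorem tail_face (d : D) : G.tail (G.next⁻¹ (G.rev d)) = G.tail (G.rev d) := by
  rw [← G.tail_next (G.next⁻¹ (G.rev d))]
  simp

theorem right_rev (d : D) : G.right (G.rev d) = G.left d := by
  simp [right, G.rev_rev]

theorem left_rev (d : D) : G.left (G.rev d) = G.right d := rfl

theorem right_next (d : D) : G.right (G.next d) = G.left d := by
  have h := G.left_face (G.rev (G.next d))
  rw [G.rev_rev] at h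
  simpa [right] using h.symm

theorem edge_eq_iff {d d' : D} : G.edge d = G.edge d' ↔ d = d' ∨ d = G.rev d' := by
  constructor
  · intro h
    obtain ⟨i, hi⟩ : Equiv.Perm.SameCycle G.rev d d' := Quotient.exact h
    have h2 : G.rev ^ (2 : ℤ) = 1 := by
      refine Equiv.ext fun x => ?_
      rw [zpow_ofNat, pow_two]
      exact G.rev_rev x
    obtain ⟨k, rfl | rfl⟩ := Int.even_or_odd' i
    · rw [zpow_mul, h2] at hi
      left
      simpa using hi
    · rw [zpow_add, zpow_mul, h2] at hi
      right
      rw [← hi]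
      simp [G.rev_rev]
  · rintro (rfl | rfl)
    · rfl
    · exact G.edge_rev d'

theorem eq_of_invariant {α : Type*} (h : D → α) (h1 : ∀ d, h (G.next d) = h d)
    (h2 : ∀ d, h (G.rev d) = h d) (a b : D) : h a = h b := by
  induction G.connected a b with
  | refl => rfl
  | tail _ hs ih =>
    rcases hs with rfl | rfl
    · rw [ih, h1]
    · rw [ih, h2]

theorem vertex_eq_of_invariant {α : Type*} (p : G.Vertex → α)
    (h : ∀ d, p (G.tail (G.rev d)) = p (G.tail d)) (v w : G.Vertex) : p v = p w := by
  induction v using Quotient.inductionOn with | _ a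
  induction w using Quotient.inductionOn with | _ b
  exact G.eq_of_invariant (fun d => p (G.tail d)) (fun d => by rw [G.tail_next]) h a b

theorem face_eq_of_invariant {α : Type*} (g : G.Face → α)
    (h : ∀ d, g (G.left d) = g (G.right d)) (v w : G.Face) : g v = g w := by
  induction v using Quotient.inductionOn with | _ a
  induction w using Quotient.inductionOn with | _ b
  exact G.eq_of_invariant (fun d => g (G.left d))
    (fun d => by rw [h, G.right_next]) (fun d => (h d).symm) a b

/-- A function on darts that is invariant along the boundary walk of a face is constant on it. -/
theorem eq_of_left_eq {α : Type*} [Finite D] (h : D → α) (F : G.Face)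
    (hF : ∀ d, G.left d = F → h (G.next⁻¹ (G.rev d)) = h d) {a b : D}
    (ha : G.left a = F) (hb : G.left b = F) : h a = h b := by
  have hab : Equiv.Perm.SameCycle (G.next⁻¹ * G.rev) a b := Quotient.exact (ha.trans hb.symm)
  obtain ⟨k, rfl⟩ := hab.exists_nat_pow_eq
  clear hab hb
  suffices H : ∀ k : ℕ, G.left (((G.next⁻¹ * G.rev) ^ k) a) = F ∧
      h (((G.next⁻¹ * G.rev) ^ k) a) = h a from (H k).2.symm
  intro k
  induction k with
  | zero => exact ⟨ha, rfl⟩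
  | succ k ih =>
    rw [pow_succ', Equiv.Perm.mul_apply]
    refine ⟨?_, ?_⟩
    · rw [← ih.1]; exact G.left_face _
    · rw [← ih.2]; exact hF _ ih.1

end Basics

/-! ### Discrete Hodge theory on the sphere. -/

section Hodge

variable {D : Type*} (G : PlaneGraph D)

/-- The coboundary of a function on the vertices. -/
def vcob : (G.Vertex → ℚ) →ₗ[ℚ] (D → ℚ) where
  toFun p d := p (G.tail (G.rev d)) - p (G.tail d)
  map_add' p q := by ext d; simp; ring
  map_smul' c p := by ext d; simp; ring

/-- The coboundary of a function on the faces. -/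
def fcob : (G.Face → ℚ) →ₗ[ℚ] (D → ℚ) where
  toFun g d := g (G.left d) - g (G.right d)
  map_add' p q := by ext d; simp; ring
  map_smul' c p := by ext d; simp; ring

theorem vcob_apply (p : G.Vertex → ℚ) (d : D) :
    G.vcob p d = p (G.tail (G.rev d)) - p (G.tail d) := rfl

theorem fcob_apply (g : G.Face → ℚ) (d : D) : G.fcob g d = g (G.left d) - g (G.right d) := rfl

/-- The antisymmetric functions on the darts. -/
def anti : Submodule ℚ (D → ℚ) where
  carrier := {c | ∀ d, c (G.rev d) = -c d}
  add_mem' {a b} ha hb d := by simp [ha d, hb d]; ring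
  zero_mem' d := by simp
  smul_mem' r a ha d := by simp [ha d]

theorem mem_anti {c : D → ℚ} : c ∈ G.anti ↔ ∀ d, c (G.rev d) = -c d := Iff.rfl

theorem vcob_mem_anti (p : G.Vertex → ℚ) : G.vcob p ∈ G.anti := fun d => by
  simp [vcob_apply, G.rev_rev]

theorem fcob_mem_anti (g : G.Face → ℚ) : G.fcob g ∈ G.anti := fun d => by
  simp [fcob_apply, right_rev, left_rev]

/-- The kernel contains only constants, hence has dimension at most one; then rank-nullity. -/
theorem card_le_finrank_range_add_one {α : Type*} [Finite α] (f : (α → ℚ) →ₗ[ℚ] (D → ℚ))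
    (h : ∀ p, f p = 0 → ∀ a b, p a = p b) :
    Nat.card α ≤ Module.finrank ℚ (LinearMap.range f) + 1 := by
  have : Fintype α := Fintype.ofFinite _
  have h1 := LinearMap.finrank_range_add_finrank_ker f
  have h2 : Module.finrank ℚ (LinearMap.ker f) ≤ 1 := by
    rcases isEmpty_or_nonempty α with hα | ⟨⟨a⟩⟩
    · have := Submodule.finrank_le (LinearMap.ker f)
      rw [Module.finrank_fintype_fun_eq_card, Fintype.card_eq_zero] at this
      omega
    · let ev : LinearMap.ker f →ₗ[ℚ] ℚ := (LinearMap.proj a).comp (LinearMap.ker f).subtype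
      have hev : Function.Injective ev := by
        rw [← LinearMap.ker_eq_bot, LinearMap.ker_eq_bot']
        intro p hp
        ext b
        have : p.1 b = p.1 a := h p.1 p.2 b a
        exact this.trans hp
      simpa using LinearMap.finrank_le_finrank_of_injective hev
  rw [Module.finrank_fintype_fun_eq_card, ← Nat.card_eq_fintype_card] at h1
  omega

variable [Fintype D]

/-- Around a vertex the differences telescope, because `right (next d) = left d`. -/
theorem sum_tail_fcob (p : G.Vertex → ℚ) (g : G.Face → ℚ) :
    ∑ d, p (G.tail d) * G.fcob g d = 0 := by
  simp only [fcob_apply, mul_sub, Finset.sum_sub_distrib]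
  rw [sub_eq_zero, ← Equiv.sum_comp G.next (fun d => p (G.tail d) * g (G.right d))]
  simp [tail_next, right_next]

theorem sum_vcob_mul (p : G.Vertex → ℚ) {c : D → ℚ} (hc : c ∈ G.anti)
    (h : ∑ d, p (G.tail d) * c d = 0) : ∑ d, G.vcob p d * c d = 0 := by
  simp only [vcob_apply, sub_mul, Finset.sum_sub_distrib, h]
  rw [← Equiv.sum_comp G.rev (fun d => p (G.tail (G.rev d)) * c d)]
  simp only [G.rev_rev, G.mem_anti.1 hc, mul_neg, Finset.sum_neg_distrib, h]
  simp

theorem sum_fcob_mul (g : G.Face → ℚ) {c : D → ℚ} (hc : c ∈ G.anti)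
    (h : ∑ d, g (G.left d) * c d = 0) : ∑ d, G.fcob g d * c d = 0 := by
  simp only [fcob_apply, sub_mul, Finset.sum_sub_distrib, h]
  rw [← Equiv.sum_comp G.rev (fun d => g (G.right d) * c d)]
  simp only [right_rev, G.mem_anti.1 hc, mul_neg, Finset.sum_neg_distrib, h]
  simp

theorem sum_vcob_fcob (p : G.Vertex → ℚ) (g : G.Face → ℚ) :
    ∑ d, G.vcob p d * G.fcob g d = 0 :=
  G.sum_vcob_mul p (G.fcob_mem_anti g) (G.sum_tail_fcob p g)

theorem eq_zero_of_sum_sq {c : D → ℚ} (h : ∑ d, c d * c d = 0) : c = 0 := by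
  rw [Finset.sum_eq_zero_iff_of_nonneg fun d _ => mul_self_nonneg _] at h
  ext d
  simpa using h d (Finset.mem_univ d)

theorem finrank_anti_le : Module.finrank ℚ G.anti ≤ Nat.card G.Edge := by
  classical
  have : Fintype G.Edge := Fintype.ofFinite _
  let f : G.anti →ₗ[ℚ] (G.Edge → ℚ) :=
    { toFun := fun c e => c.1 e.out
      map_add' := fun a b => rfl
      map_smul' := fun r a => rfl }
  have hf : Function.Injective f := by
    rw [← LinearMap.ker_eq_bot, LinearMap.ker_eq_bot']
    intro c hc
    ext d
    have h1 : c.1 (G.edge d).out = 0 := congrFun hc (G.edge d)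
    have h2 : G.edge (G.edge d).out = G.edge d := Quotient.out_eq _
    rcases G.edge_eq_iff.1 h2 with h | h
    · rw [h] at h1; simpa using h1
    · rw [h, c.2 d] at h1; simpa using h1
  have := LinearMap.finrank_le_finrank_of_injective hf
  rwa [Module.finrank_fintype_fun_eq_card, ← Nat.card_eq_fintype_card] at this

/-- The discrete Hodge decomposition on the sphere: there are no harmonic functions. -/
theorem exists_eq_vcob_add_fcob {c : D → ℚ} (hc : c ∈ G.anti) :
    ∃ p g, c = G.vcob p + G.fcob g := by
  have hdisj : LinearMap.range G.vcob ⊓ LinearMap.range G.fcob = ⊥ := by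
    rw [eq_bot_iff]
    rintro x ⟨⟨p, hp⟩, ⟨g, hg⟩⟩
    refine (Submodule.mem_bot ℚ).2 (eq_zero_of_sum_sq ?_)
    have h := G.sum_vcob_fcob p g
    rwa [hp, hg] at h
  have hle : LinearMap.range G.vcob ⊔ LinearMap.range G.fcob ≤ G.anti := by
    rw [sup_le_iff]
    constructor
    · rintro _ ⟨p, rfl⟩; exact G.vcob_mem_anti p
    · rintro _ ⟨p, rfl⟩; exact G.fcob_mem_anti p
  have h1 := Submodule.finrank_sup_add_finrank_inf_eq (LinearMap.range G.vcob)
    (LinearMap.range G.fcob)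
  rw [hdisj, finrank_bot] at h1
  have hv := card_le_finrank_range_add_one G.vcob fun p hp a b =>
    G.vertex_eq_of_invariant p (fun d => sub_eq_zero.1 (congrFun hp d)) a b
  have hf := card_le_finrank_range_add_one G.fcob fun p hp a b =>
    G.face_eq_of_invariant p (fun d => sub_eq_zero.1 (congrFun hp d)) a b
  have he := G.euler
  have ha := G.finrank_anti_le
  -- The two orthogonal ranges have dimensions at least $v-1$ and $f-1$, and by Euler's formula
  -- these add up to $e$, which bounds the dimension of `anti`.
  have heq := Submodule.eq_of_le_of_finrank_le hle (by
    simp only [Vertex, Edge, Face] at hv hf ha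
    omega)
  rw [← heq] at hc
  obtain ⟨_, ⟨p, rfl⟩, _, ⟨g, rfl⟩, h⟩ := Submodule.mem_sup.1 hc
  exact ⟨p, g, h.symm⟩

/-- Vanishing face sums make `c` orthogonal to all face coboundaries, so its `fcob` component is
orthogonal to itself. -/
theorem exists_eq_vcob {c : D → ℚ} (hc : c ∈ G.anti)
    (h : ∀ g : G.Face → ℚ, ∑ d, g (G.left d) * c d = 0) : ∃ p, c = G.vcob p := by
  obtain ⟨p, g, rfl⟩ := G.exists_eq_vcob_add_fcob hc
  have h1 := G.sum_fcob_mul g hc (h g)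
  have h2 := G.sum_vcob_fcob p g
  refine ⟨p, ?_⟩
  have : G.fcob g = 0 := by
    refine eq_zero_of_sum_sq ?_
    simp only [Pi.add_apply, mul_add, Finset.sum_add_distrib] at h1
    simp only [mul_comm (G.fcob g _) (G.vcob p _), h2, zero_add] at h1
    exact h1
  simp [this]

theorem exists_eq_fcob {c : D → ℚ} (hc : c ∈ G.anti)
    (h : ∀ p : G.Vertex → ℚ, ∑ d, p (G.tail d) * c d = 0) : ∃ g, c = G.fcob g := by
  obtain ⟨p, g, rfl⟩ := G.exists_eq_vcob_add_fcob hc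
  have h1 := G.sum_vcob_mul p hc (h p)
  have h2 := G.sum_vcob_fcob p g
  refine ⟨g, ?_⟩
  have : G.vcob p = 0 := by
    refine eq_zero_of_sum_sq ?_
    simp only [Pi.add_apply, mul_add, Finset.sum_add_distrib, h2, add_zero] at h1
    exact h1
  simp [this]

end Hodge

end PlaneGraph

namespace PlaneGraph

/-! ### No edge has the unbounded face on both sides. -/

section OuterBridges

variable {D : Type*} (G : PlaneGraph D)

/-- `A` is the set of vertices on the side of the head of `b`, for a bridge `b`. -/
def IsSide (b : D) (A : Set G.Vertex) : Prop :=
  G.tail (G.rev b) ∈ A ∧ G.tail b ∉ A ∧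
    ∀ d, d ≠ b → d ≠ G.rev b → (G.tail (G.rev d) ∈ A ↔ G.tail d ∈ A)

theorem IsSide.compl {b : D} {A : Set G.Vertex} (h : G.IsSide b A) : G.IsSide (G.rev b) Aᶜ := by
  refine ⟨by rw [G.rev_rev]; exact h.2.1, fun h' => h' h.1, fun d h1 h2 => ?_⟩
  rw [G.rev_rev] at h2
  exact not_congr (h.2.2 d h2 h1)

/-- The signed indicator of `b` has zero face sums, since `b` and its reverse lie on the same face.
Its vertex potential jumps only across `b`, and a level set of it is the side. -/
theorem exists_isSide [Finite D] {b : D} (hb : G.left b = G.right b) : ∃ A, G.IsSide b A := by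
  classical
  have : Fintype D := Fintype.ofFinite D
  let c : D → ℚ := fun d => (if d = b then 1 else 0) - (if d = G.rev b then 1 else 0)
  have hne := G.rev_ne b
  have hc : c ∈ G.anti := by
    intro d
    have h1 : G.rev d = b ↔ d = G.rev b :=
      ⟨fun h => by rw [← h, G.rev_rev], fun h => by rw [h, G.rev_rev]⟩
    simp only [c, h1, G.rev.injective.eq_iff]
    ring
  obtain ⟨p, hp⟩ := G.exists_eq_vcob hc fun g => by
    simp only [c, mul_sub, Finset.sum_sub_distrib, mul_ite, mul_one, mul_zero,
      Finset.sum_ite_eq', Finset.mem_univ, if_true]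
    rw [hb, left_rev, sub_self]
  have hp' : ∀ d, p (G.tail (G.rev d)) - p (G.tail d) = c d := fun d => (congrFun hp d).symm
  refine ⟨{v | p v = p (G.tail (G.rev b))}, rfl, ?_, ?_⟩
  · intro h
    have h1 := hp' b
    have h2 : p (G.tail b) = p (G.tail (G.rev b)) := h
    simp [c, h2, hne.symm] at h1
  · intro d h1 h2
    have h3 := hp' d
    simp only [c, h1, h2, if_false, sub_zero] at h3
    simp only [Set.mem_ofPred_eq, sub_eq_zero.1 h3]

/-- The next dart `d` at the head of `b` is not `rev b`, as there are no leaves, and has the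
unbounded face on its right. Either its left face is bounded, or `d` is again a bridge whose far
side is strictly smaller. -/
theorem exists_left_ne_outer_of_isSide [Finite D] (hleaf : G.NoLeaves) (n : ℕ) :
    ∀ (b : D) (A : Set G.Vertex), G.left b = G.outer → G.right b = G.outer → G.IsSide b A →
      A.ncard = n → ∃ a, G.left a ≠ G.outer ∧ G.tail a ∈ A := by
  induction n using Nat.strong_induction_on with
  | _ n ih =>
  intro b A hl hr hA hn
  set d := G.next (G.rev b) with hd
  have htail : G.tail d = G.tail (G.rev b) := G.tail_next _
  have hd1 : d ≠ G.rev b := hleaf _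
  have hd2 : d ≠ b := fun h => hA.2.1 (by rw [← h, htail]; exact hA.1)
  have hd3 : b ≠ G.rev d := fun h => hd1 (by rw [h, G.rev_rev])
  have hd4 : G.rev b ≠ G.rev d := fun h => hd2 (G.rev.injective h).symm
  have hrd : G.right d = G.outer := by rw [hd, right_next, left_rev, hr]
  by_cases hld : G.left d = G.outer
  · obtain ⟨A', hA'⟩ := G.exists_isSide (b := d) (hld.trans hrd.symm)
    have hh : G.tail (G.rev b) ∉ A' := by rw [← htail]; exact hA'.2.1
    have ht : G.tail b ∉ A' := fun h => hh ((hA'.2.2 b hd2.symm hd3).2 h)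
    have hdA : G.tail (G.rev d) ∈ A := (hA.2.2 d hd2 hd1).2 (by rw [htail]; exact hA.1)
    have hsub : A' ⊆ A := by
      intro v hv
      by_contra hvA
      -- No edge leaves $A'\setminus A$: both ends of `b` are outside `A'`, both ends of `d` are in
      -- `A`. By connectedness this set is everything or empty, and it misses the head of `b`.
      have key := G.vertex_eq_of_invariant (fun v => v ∈ A' ∧ v ∉ A) (fun e => by
        by_cases h1 : e = b
        · subst h1; simp [hh, ht]
        by_cases h2 : e = G.rev b
        · subst h2; simp [hh, ht, G.rev_rev]
        by_cases h3 : e = d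
        · rw [h3]; simp [hdA, htail, hA.1]
        by_cases h4 : e = G.rev d
        · rw [h4]; simp [hdA, htail, hA.1, G.rev_rev]
        simp only [hA.2.2 e h1 h2, hA'.2.2 e h3 h4]) v (G.tail (G.rev b))
      have : G.tail (G.rev b) ∈ A' ∧ G.tail (G.rev b) ∉ A := by
        rw [← key]; exact ⟨hv, hvA⟩
      exact hh this.1
    have hlt : A'.ncard < n := by
      rw [← hn]
      exact Set.ncard_lt_ncard ⟨hsub, fun h => hh (h hA.1)⟩ (Set.toFinite _)
    obtain ⟨a, ha1, ha2⟩ := ih _ hlt d A' hld hrd hA' rfl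
    exact ⟨a, ha1, hsub ha2⟩
  · exact ⟨d, hld, by rw [htail]; exact hA.1⟩

/-- The bounded faces on one side of a bridge. -/
def facesOn (A : Set G.Vertex) : Set G.BoundedFace := {F | ∃ a, G.left a = F.1 ∧ G.tail a ∈ A}

theorem tail_mem_iff_of_isSide [Finite D] {b : D} {A : Set G.Vertex} (hl : G.left b = G.outer)
    (hr : G.right b = G.outer) (hA : G.IsSide b A) (F : G.BoundedFace) {a a' : D}
    (ha : G.left a = F.1) (ha' : G.left a' = F.1) : G.tail a ∈ A ↔ G.tail a' ∈ A := by
  refine iff_of_eq (G.eq_of_left_eq (fun d => G.tail d ∈ A) F.1 (fun d hd => ?_) ha ha')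
  rw [tail_face]
  refine propext (hA.2.2 d ?_ ?_)
  · rintro rfl; exact F.2 (hd.symm.trans hl)
  · rintro rfl; exact F.2 (hd.symm.trans hr)

theorem left_ne_outer_or_right_ne_outer [Finite D] (hleaf : G.NoLeaves)
    (hcard : Nat.card G.Edge = 3 * Nat.card G.BoundedFace)
    (hcon : G.NoProperContractible) (b : D) : G.left b ≠ G.outer ∨ G.right b ≠ G.outer := by
  by_contra! hb
  obtain ⟨hl, hr⟩ := hb
  obtain ⟨A, hA⟩ := G.exists_isSide (hl.trans hr.symm)
  obtain ⟨a, ha1, ha2⟩ := G.exists_left_ne_outer_of_isSide hleaf _ b A hl hr hA rfl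
  obtain ⟨a', ha'1, ha'2⟩ := G.exists_left_ne_outer_of_isSide hleaf _ (G.rev b) Aᶜ hr
    (by rw [right_rev]; exact hl) hA.compl rfl
  set S := G.facesOn A with hS
  have hiff : ∀ (F : G.BoundedFace) (x : D), G.left x = F.1 → (F ∈ S ↔ G.tail x ∈ A) := by
    intro F x hx
    constructor
    · rintro ⟨y, hy, hyA⟩
      exact (G.tail_mem_iff_of_isSide hl hr hA F hy hx).1 hyA
    · exact fun h => ⟨x, hx, h⟩
  have haS : (⟨_, ha1⟩ : G.BoundedFace) ∈ S := (hiff _ a rfl).2 ha2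
  have haS' : (⟨_, ha'1⟩ : G.BoundedFace) ∉ S := fun h => ha'2 ((hiff _ a' rfl).1 h)
  have h1 : ¬ G.Contractible S := hcon S ⟨_, haS⟩ fun h => haS' (h ▸ Set.mem_univ _)
  have h2 : ¬ G.Contractible Sᶜ := hcon Sᶜ ⟨_, haS'⟩ fun h => by
    have : (⟨_, ha1⟩ : G.BoundedFace) ∈ Sᶜ := h ▸ Set.mem_univ _
    exact this haS
  have hdisj : Disjoint (G.edgesOf S) (G.edgesOf Sᶜ) := by
    rw [Set.disjoint_left]
    rintro e ⟨F, hF, d, hd, hdF⟩ ⟨F', hF', d', hd', hdF'⟩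
    rw [hiff F d hdF] at hF
    rw [Set.mem_compl_iff, hiff F' d' hdF'] at hF'
    have hdb : d ≠ b := by rintro rfl; exact F.2 (hdF.symm.trans hl)
    have hdb' : d ≠ G.rev b := by rintro rfl; exact F.2 (hdF.symm.trans hr)
    rcases G.edge_eq_iff.1 (hd'.trans hd.symm) with rfl | rfl
    · exact hF' hF
    · exact hF' ((hA.2.2 d hdb hdb').2 hF)
  have hbU : G.edge b ∉ G.edgesOf S ∪ G.edgesOf Sᶜ := by
    have : ∀ F : G.BoundedFace, ¬ G.OnFace (G.edge b) F.1 := by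
      rintro F ⟨d, hd, hdF⟩
      rcases G.edge_eq_iff.1 hd with rfl | rfl
      · exact F.2 (hdF.symm.trans hl)
      · exact F.2 (hdF.symm.trans hr)
    rintro (⟨F, -, hF⟩ | ⟨F, -, hF⟩) <;> exact this F hF
  -- Both parts are non-contractible with disjoint edge sets, and `b` is in neither, so
  -- $e_G\ge(3f_S+1)+(3f_{S^c}+1)+1>3f_G$.
  have h3 := Set.ncard_insert_of_notMem hbU (Set.toFinite _)
  rw [Set.ncard_union_eq hdisj (Set.toFinite _) (Set.toFinite _)] at h3
  have h4 := Set.ncard_le_card (insert (G.edge b) (G.edgesOf S ∪ G.edgesOf Sᶜ))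
  have h5 := Set.ncard_add_ncard_compl S
  unfold Contractible at h1 h2
  omega

end OuterBridges

/-! ### Edge-injective functions from Hall's marriage theorem. -/

section Existence

variable {D : Type*} (G : PlaneGraph D)

theorem exists_onFace [Finite D] (hleaf : G.NoLeaves)
    (hcard : Nat.card G.Edge = 3 * Nat.card G.BoundedFace)
    (hcon : G.NoProperContractible) (e : G.Edge) : ∃ F : G.BoundedFace, G.OnFace e F.1 := by
  induction e using Quotient.inductionOn with | _ d
  rcases G.left_ne_outer_or_right_ne_outer hleaf hcard hcon d with h | h
  · exact ⟨⟨_, h⟩, d, rfl, rfl⟩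
  · exact ⟨⟨_, h⟩, G.rev d, G.edge_rev d, rfl⟩

theorem nonempty_edgeInjective [Finite D] (hleaf : G.NoLeaves)
    (hcard : Nat.card G.Edge = 3 * Nat.card G.BoundedFace)
    (hcon : G.NoProperContractible) : Nonempty G.EdgeInjective := by
  classical
  have : Fintype G.Edge := Fintype.ofFinite _
  have : Fintype G.BoundedFace := Fintype.ofFinite _
  -- Each face occurs three times, so a system of distinct representatives provides the triples.
  let t : G.BoundedFace × Fin 3 → Finset G.Edge := fun x =>
    Finset.univ.filter fun e => G.OnFace e x.1.1
  have hall : ∀ s : Finset (G.BoundedFace × Fin 3), s.card ≤ (s.biUnion t).card := by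
    intro s
    rcases s.eq_empty_or_nonempty with rfl | hs
    · simp
    set S : Finset G.BoundedFace := s.image Prod.fst with hS
    have h1 : s.card ≤ 3 * S.card := by
      calc s.card ≤ (S ×ˢ (Finset.univ : Finset (Fin 3))).card := by
            refine Finset.card_le_card fun x hx => ?_
            simp only [Finset.mem_product, Finset.mem_univ, and_true]
            exact Finset.mem_image_of_mem _ hx
        _ = 3 * S.card := by simp [mul_comm]
    have h2 : (s.biUnion t : Set G.Edge) = G.edgesOf (S : Set G.BoundedFace) := by
      ext e
      simp only [hS, t, edgesOf, Finset.coe_biUnion, Set.mem_iUnion, Finset.coe_filter,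
        Finset.mem_univ, true_and, Set.mem_ofPred_eq, Finset.coe_image, Finset.mem_coe,
        Set.mem_image, exists_prop]
      constructor
      · rintro ⟨x, hx, he⟩
        exact ⟨x.1, ⟨x, hx, rfl⟩, he⟩
      · rintro ⟨_, ⟨x, hx, rfl⟩, he⟩
        exact ⟨x, hx, he⟩
    have h3 : (s.biUnion t).card = (G.edgesOf (S : Set G.BoundedFace)).ncard := by
      rw [← h2, Set.ncard_coe_finset]
    refine h1.trans ?_
    rw [h3]
    by_cases hu : (S : Set G.BoundedFace) = Set.univ
    · have hU : G.edgesOf (S : Set G.BoundedFace) = Set.univ := by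
        rw [hu, Set.eq_univ_iff_forall]
        intro e
        obtain ⟨F, hF⟩ := G.exists_onFace hleaf hcard hcon e
        exact ⟨F, Set.mem_univ _, hF⟩
      rw [hU, Set.ncard_univ, hcard, ← Set.ncard_coe_finset S, hu, Set.ncard_univ]
    · have h4 := hcon (S : Set G.BoundedFace) (by
        rw [Finset.coe_nonempty]; exact hs.image _) hu
      unfold Contractible at h4
      rw [Set.ncard_coe_finset] at h4
      omega
  obtain ⟨f, hf, hft⟩ := (Finset.all_card_le_biUnion_card_iff_exists_injective t).1 hall
  refine ⟨⟨fun F => Finset.univ.image fun i => f (F, i), fun F => ?_, fun F e he => ?_,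
    fun F F' hF => ?_⟩⟩
  · rw [Finset.card_image_of_injective _ fun i j h => congrArg Prod.snd (hf h)]
    simp
  · obtain ⟨i, -, rfl⟩ := Finset.mem_image.1 he
    exact (Finset.mem_filter.1 (hft (F, i))).2
  · rw [Finset.disjoint_left]
    intro e he he'
    obtain ⟨i, -, rfl⟩ := Finset.mem_image.1 he
    obtain ⟨j, -, h⟩ := Finset.mem_image.1 he'
    exact hF (congrArg Prod.fst (hf h)).symm

end Existence

end PlaneGraph

namespace PlaneGraph

/-! ### Reversing balanced edge sets. -/

section Flips

variable {D : Type*} {G : PlaneGraph D}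

theorem onFace_edge_iff {d : D} {F : G.Face} :
    G.OnFace (G.edge d) F ↔ G.left d = F ∨ G.right d = F := by
  constructor
  · rintro ⟨d', h, rfl⟩
    rcases G.edge_eq_iff.1 h with rfl | rfl
    · exact Or.inl rfl
    · exact Or.inr rfl
  · rintro (rfl | rfl)
    · exact ⟨d, rfl, rfl⟩
    · exact ⟨G.rev d, G.edge_rev d, rfl⟩

/-- An edge has at most two faces. -/
theorem eq_or_eq_of_onFace {e : G.Edge} {F F' F'' : G.Face} (h : G.OnFace e F)
    (h' : G.OnFace e F') (hne : F ≠ F') (h'' : G.OnFace e F'') : F'' = F ∨ F'' = F' := by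
  induction e using Quotient.inductionOn with | _ d
  rcases onFace_edge_iff.1 h with rfl | rfl <;> rcases onFace_edge_iff.1 h' with rfl | rfl <;>
    rcases onFace_edge_iff.1 h'' with rfl | rfl <;> simp_all

theorem eq_of_onFace {e : G.Edge} {F F' F'' : G.BoundedFace} (h : G.OnFace e F.1)
    (h' : G.OnFace e F'.1) (h'' : G.OnFace e F''.1) (h1 : F' ≠ F) (h2 : F'' ≠ F) : F' = F'' := by
  rcases eq_or_eq_of_onFace h h' (fun h => h1 (Subtype.ext h.symm)) h'' with h | h
  · exact absurd (Subtype.ext h) h2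
  · exact (Subtype.ext h).symm

theorem EdgeInjective.onFace (φ : G.EdgeInjective) {e : G.Edge} {F : G.BoundedFace}
    (h : e ∈ φ.1 F) : G.OnFace e F.1 := φ.2.2.1 F e h

theorem EdgeInjective.mem_unique (φ : G.EdgeInjective) {e : G.Edge} {F F' : G.BoundedFace}
    (h : e ∈ φ.1 F) (h' : e ∈ φ.1 F') : F = F' := by
  by_contra hne
  exact Finset.disjoint_left.1 (φ.2.2.2 F F' hne) h h'

theorem EdgeInjective.exists_mem [Finite D] (hcard : Nat.card G.Edge = 3 * Nat.card G.BoundedFace)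
    (φ : G.EdgeInjective) (e : G.Edge) : ∃ F, e ∈ φ.1 F := by
  classical
  have : Fintype G.Edge := Fintype.ofFinite _
  have : Fintype G.BoundedFace := Fintype.ofFinite _
  have h : (Finset.univ.biUnion φ.1).card = Fintype.card G.Edge := by
    rw [Finset.card_biUnion fun F _ F' _ hne => φ.2.2.2 F F' hne]
    simp only [φ.2.1, Finset.sum_const, smul_eq_mul, Finset.card_univ,
      ← Nat.card_eq_fintype_card, hcard, mul_comm]
  rw [Finset.card_eq_iff_eq_univ] at h
  have he : e ∈ Finset.univ.biUnion φ.1 := by rw [h]; exact Finset.mem_univ e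
  obtain ⟨F, -, hF⟩ := Finset.mem_biUnion.1 he
  exact ⟨F, hF⟩

theorem EdgeInjective.ext_of_forall {φ ψ : G.EdgeInjective}
    (h : ∀ F e, e ∈ φ.1 F ↔ e ∈ ψ.1 F) : φ = ψ :=
  Subtype.ext (funext fun F => Finset.ext (h F))

/-- The edge is shared by two bounded faces. -/
def Inner (e : G.Edge) : Prop :=
  ∃ F F' : G.BoundedFace, F ≠ F' ∧ G.OnFace e F.1 ∧ G.OnFace e F'.1

/-- The contribution of an edge to the in-degree of `F` minus its contribution to the
out-degree. -/
noncomputable def weight (φ : G.EdgeInjective) (F : G.BoundedFace) (e : G.Edge) : ℤ :=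
  open Classical in
  (if e ∈ φ.1 F then 1 else 0) - (if G.OnFace e F.1 ∧ e ∉ φ.1 F then 1 else 0)

/-- In-degrees and out-degrees agree on the set `C` of non-loops of the modified dual. -/
def Balanced (φ : G.EdgeInjective) (C : Set G.Edge) : Prop :=
  (∀ e ∈ C, Inner e) ∧ ∀ F, ∑ᶠ e ∈ C, weight φ F e = 0

/-- `ψ` arises from `φ` by reversing the edges in `C`. -/
def IsFlip (φ : G.EdgeInjective) (C : Set G.Edge) (ψ : G.EdgeInjective) : Prop :=
  ∀ F e, e ∈ ψ.1 F ↔ (e ∈ C ∧ G.OnFace e F.1 ∧ e ∉ φ.1 F) ∨ (e ∉ C ∧ e ∈ φ.1 F)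

/-- The edges on which the orientations given by `φ` and `ψ` differ. -/
def diff (φ ψ : G.EdgeInjective) : Set G.Edge := {e | ∃ F, e ∈ φ.1 F ∧ e ∉ ψ.1 F}

theorem IsFlip.unique {φ ψ ψ' : G.EdgeInjective} {C : Set G.Edge} (h : IsFlip φ C ψ)
    (h' : IsFlip φ C ψ') : ψ = ψ' :=
  EdgeInjective.ext_of_forall fun F e => by rw [h F e, h' F e]

theorem ite_mem_eq_sub_weight {φ : G.EdgeInjective} {C : Set G.Edge} {F : G.BoundedFace}
    {s : Finset G.Edge}
    (h : ∀ e, e ∈ s ↔ (e ∈ C ∧ G.OnFace e F.1 ∧ e ∉ φ.1 F) ∨ (e ∉ C ∧ e ∈ φ.1 F)) (e : G.Edge) :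
    (open Classical in if e ∈ s then (1 : ℤ) else 0) =
      (open Classical in if e ∈ φ.1 F then (1 : ℤ) else 0) - C.indicator (weight φ F) e := by
  by_cases h1 : e ∈ C <;> by_cases h2 : e ∈ φ.1 F <;> by_cases h3 : G.OnFace e F.1 <;>
    simp [h e, h1, h2, h3, weight]

/-- Reversing `C` changes the in-degree of `F` by out-degree minus in-degree within `C`; it stays
three exactly when the weights cancel. -/
theorem card_eq_sub_weight [Finite D] {φ : G.EdgeInjective} {C : Set G.Edge} {F : G.BoundedFace}
    {s : Finset G.Edge}
    (h : ∀ e, e ∈ s ↔ (e ∈ C ∧ G.OnFace e F.1 ∧ e ∉ φ.1 F) ∨ (e ∉ C ∧ e ∈ φ.1 F)) :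
    (s.card : ℤ) = 3 - ∑ᶠ e ∈ C, weight φ F e := by
  classical
  have : Fintype G.Edge := Fintype.ofFinite _
  have key : ∀ s : Finset G.Edge, (s.card : ℤ) = ∑ e, if e ∈ s then (1 : ℤ) else 0 := by
    intro s
    simp
  have h3 : (3 : ℤ) = ∑ e, if e ∈ φ.1 F then (1 : ℤ) else 0 := by
    rw [← key, φ.2.1 F]
    rfl
  rw [finsum_mem_def, finsum_eq_sum_of_fintype, key s, h3, ← Finset.sum_sub_distrib]
  refine Finset.sum_congr rfl fun e _ => ?_
  convert ite_mem_eq_sub_weight h e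

theorem IsFlip.balanced [Finite D] {φ ψ : G.EdgeInjective} {C : Set G.Edge} (h : IsFlip φ C ψ)
    (hC : ∀ e ∈ C, Inner e) : Balanced φ C := by
  refine ⟨hC, fun F => ?_⟩
  have := card_eq_sub_weight (h F)
  rw [ψ.2.1 F] at this
  push_cast at this
  linarith

theorem Balanced.exists_isFlip [Finite D] (hcov : ∀ (φ : G.EdgeInjective) e, ∃ F, e ∈ φ.1 F)
    {φ : G.EdgeInjective} {C : Set G.Edge} (h : Balanced φ C) : ∃ ψ, IsFlip φ C ψ := by
  classical
  have : Fintype G.Edge := Fintype.ofFinite _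
  let s : G.BoundedFace → Finset G.Edge := fun F => Finset.univ.filter fun e =>
    (e ∈ C ∧ G.OnFace e F.1 ∧ e ∉ φ.1 F) ∨ (e ∉ C ∧ e ∈ φ.1 F)
  have hs : ∀ F e, e ∈ s F ↔ (e ∈ C ∧ G.OnFace e F.1 ∧ e ∉ φ.1 F) ∨ (e ∉ C ∧ e ∈ φ.1 F) :=
    fun F e => by simp [s]
  refine ⟨⟨s, fun F => ?_, fun F e he => ?_, fun F F' hne => ?_⟩, hs⟩
  · have h1 := card_eq_sub_weight (hs F)
    rw [h.2 F] at h1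
    omega
  · rcases (hs F e).1 he with h1 | h1
    · exact h1.2.1
    · exact φ.onFace h1.2
  · rw [Finset.disjoint_left]
    intro e he he'
    rcases (hs F e).1 he with h1 | h1 <;> rcases (hs F' e).1 he' with h2 | h2
    -- An edge has at most two faces and one of them owns it under `φ`, so only one face can receive
    -- it on reversal.
    · obtain ⟨F'', hF''⟩ := hcov φ e
      refine hne (eq_of_onFace (φ.onFace hF'') h1.2.1 h2.2.1 ?_ ?_)
      · rintro rfl; exact h1.2.2 hF''
      · rintro rfl; exact h2.2.2 hF''
    · exact h2.1 h1.1
    · exact h1.1 h2.1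
    · exact hne (φ.mem_unique h1.2 h2.2)

theorem DualJoins.symm {e : G.Edge} {F F' : G.BoundedFace} (h : G.DualJoins e F F') :
    G.DualJoins e F' F := by
  rcases h with ⟨h1, h2, h3⟩ | ⟨rfl, h2, h3⟩
  · exact Or.inl ⟨h1.symm, h3, h2⟩
  · exact Or.inr ⟨rfl, h2, h3⟩

/-- Reversing a loop leaves its arrow unchanged, so only the non-loops of `C` need to be flipped.
This matters for `faceCycle v`, which may contain loops. -/
theorem IsFlip.reverses (hcov : ∀ (φ : G.EdgeInjective) e, ∃ F, e ∈ φ.1 F)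
    {φ ψ : G.EdgeInjective} {C : Set G.Edge} (h : IsFlip φ {e | e ∈ C ∧ Inner e} ψ) :
    Reverses C φ ψ := by
  refine ⟨fun e he F F' => ?_, fun e he F F' => ?_⟩
  · refine and_congr_right fun _ => ?_
    rw [h F' e]
    simp [he]
  · suffices H : G.DualJoins e F F' → (e ∈ φ.1 F' ↔ e ∈ ψ.1 F) from
      ⟨fun h1 => ⟨h1.1.symm, (H h1.1).1 h1.2⟩, fun h1 => ⟨h1.1.symm, (H h1.1.symm).2 h1.2⟩⟩
    rintro (⟨hne, h1, h2⟩ | ⟨rfl, h1, h2⟩)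
    · have hin : Inner e := ⟨F, F', hne, h1, h2⟩
      rw [h F e]
      simp only [Set.mem_ofPred_eq, he, hin, and_self, true_and, h1, not_true_eq_false, false_and,
        or_false]
      constructor
      · exact fun h3 h4 => hne (φ.mem_unique h4 h3)
      · intro h3
        obtain ⟨F'', hF''⟩ := hcov φ e
        have : F'' = F' := eq_of_onFace h1 (φ.onFace hF'') h2 (by rintro rfl; exact h3 hF'')
          hne.symm
        rwa [← this]
    · have hin : ¬ Inner e := by
        rintro ⟨F1, F2, hne, h3, h4⟩
        exact hne ((h2 _ h3).trans (h2 _ h4).symm)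
      rw [h F e]
      simp [hin]

theorem IsFlip.reverses_of_inner (hcov : ∀ (φ : G.EdgeInjective) e, ∃ F, e ∈ φ.1 F)
    {φ ψ : G.EdgeInjective} {C : Set G.Edge} (h : IsFlip φ C ψ) (hC : ∀ e ∈ C, Inner e) :
    Reverses C φ ψ := by
  refine IsFlip.reverses hcov ?_
  have : {e | e ∈ C ∧ Inner e} = C := Set.ext fun e => ⟨fun he => he.1, fun he => ⟨he, hC e he⟩⟩
  rwa [this]

theorem inner_of_mem_diff (hcov : ∀ (φ : G.EdgeInjective) e, ∃ F, e ∈ φ.1 F)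
    {φ ψ : G.EdgeInjective} {e : G.Edge} (h : e ∈ diff φ ψ) : Inner e := by
  obtain ⟨F, h1, h2⟩ := h
  obtain ⟨F', h3⟩ := hcov ψ e
  exact ⟨F, F', by rintro rfl; exact h2 h3, φ.onFace h1, ψ.onFace h3⟩

theorem isFlip_diff (hcov : ∀ (φ : G.EdgeInjective) e, ∃ F, e ∈ φ.1 F) (φ ψ : G.EdgeInjective) :
    IsFlip φ (diff φ ψ) ψ := by
  intro F e
  obtain ⟨F1, h1⟩ := hcov φ e
  obtain ⟨F2, h2⟩ := hcov ψ e
  have hd : e ∈ diff φ ψ ↔ F1 ≠ F2 := by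
    constructor
    · rintro ⟨F3, h3, h4⟩ rfl
      rw [φ.mem_unique h3 h1] at h4
      exact h4 h2
    · exact fun hne => ⟨F1, h1, fun h => hne (ψ.mem_unique h h2)⟩
  constructor
  · intro hF
    obtain rfl := ψ.mem_unique hF h2
    by_cases hne : F1 = F
    · subst hne
      exact Or.inr ⟨fun h => hd.1 h rfl, h1⟩
    · exact Or.inl ⟨hd.2 hne, ψ.onFace hF, fun h => hne (φ.mem_unique h1 h)⟩
  · rintro (⟨h3, h4, h5⟩ | ⟨h3, h4⟩)
    · have : F = F2 := eq_of_onFace (φ.onFace h1) h4 (ψ.onFace h2) (by rintro rfl; exact h5 h1)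
        (hd.1 h3).symm
      rwa [this]
    · obtain rfl := φ.mem_unique h1 h4
      rw [hd, not_not] at h3
      rwa [h3]

theorem balanced_diff [Finite D] (hcov : ∀ (φ : G.EdgeInjective) e, ∃ F, e ∈ φ.1 F)
    (φ ψ : G.EdgeInjective) : Balanced φ (diff φ ψ) :=
  (isFlip_diff hcov φ ψ).balanced fun _ => inner_of_mem_diff hcov

theorem eq_of_diff_eq_empty (hcov : ∀ (φ : G.EdgeInjective) e, ∃ F, e ∈ φ.1 F)
    {φ ψ : G.EdgeInjective} (h : diff φ ψ = ∅) : φ = ψ :=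
  EdgeInjective.ext_of_forall fun F e => by
    rw [isFlip_diff hcov φ ψ F e, h]
    simp

theorem IsFlip.diff_eq (hcov : ∀ (φ : G.EdgeInjective) e, ∃ F, e ∈ φ.1 F)
    {φ ψ : G.EdgeInjective} {C : Set G.Edge} (h : IsFlip φ C ψ) : diff φ ψ = C := by
  ext e
  constructor
  · rintro ⟨F, h1, h2⟩
    by_contra he
    exact h2 ((h F e).2 (Or.inr ⟨he, h1⟩))
  · intro he
    obtain ⟨F, hF⟩ := hcov φ e
    refine ⟨F, hF, fun h1 => ?_⟩
    rcases (h F e).1 h1 with h2 | h2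
    · exact h2.2.2 hF
    · exact h2.1 he

end Flips

/-! ### Balanced sets as unions of directed cycles; reachability and counting. -/

section Cycles

variable {D : Type*} {G : PlaneGraph D}

theorem weight_eq_of_arrow (φ : G.EdgeInjective) {e : G.Edge} {F F' : G.BoundedFace}
    (hne : F ≠ F') (h : Arrow φ e F F') (F'' : G.BoundedFace) :
    weight φ F'' e = (open Classical in if F' = F'' then (1 : ℤ) else 0) -
      (open Classical in if F = F'' then (1 : ℤ) else 0) := by
  obtain ⟨⟨-, h1, h2⟩ | ⟨h1, -⟩, h3⟩ := h
  · by_cases ha : F' = F''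
    · subst ha
      simp [weight, h3, hne]
    · have h4 : e ∉ φ.1 F'' := fun h => ha (φ.mem_unique h3 h)
      by_cases hb : F = F''
      · subst hb
        simp [weight, h4, h1, ha]
      · have h5 : ¬ G.OnFace e F''.1 := fun h5 => by
          rcases eq_or_eq_of_onFace h1 h2 (fun h => hne (Subtype.ext h)) h5 with h | h
          · exact hb (Subtype.ext h.symm)
          · exact ha (Subtype.ext h.symm)
        simp [weight, h4, h5, ha, hb]
  · exact absurd h1 hne

theorem inner_of_arrow {φ : G.EdgeInjective} {e : G.Edge} {F F' : G.BoundedFace}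
    (hne : F ≠ F') (h : Arrow φ e F F') : Inner e := by
  obtain ⟨⟨-, h1, h2⟩ | ⟨h1, -⟩, h3⟩ := h
  · exact ⟨F, F', hne, h1, h2⟩
  · exact absurd h1 hne

theorem IsDirectedCycle.nonempty {φ : G.EdgeInjective} {C : Set G.Edge}
    (h : IsDirectedCycle φ C) : C.Nonempty := by
  obtain ⟨n, F, e, -, -, rfl⟩ := h
  exact Set.range_nonempty e

theorem IsDirectedCycle.balanced {φ : G.EdgeInjective} {C : Set G.Edge}
    (h : IsDirectedCycle φ C) : Balanced φ C := by
  obtain ⟨n, F, e, hF, ha, rfl⟩ := h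
  have hne : ∀ i, F i ≠ F (i + 1) := fun i h => by
    have := hF h
    simp at this
  refine ⟨?_, fun F' => ?_⟩
  · rintro _ ⟨i, rfl⟩
    exact inner_of_arrow (hne i) (ha i)
  -- The edge `e i` determines its owner `F (i + 1)`, hence `i`.
  · have he : Function.Injective e := fun i j hij => by
      have h1 := (ha i).2
      rw [hij] at h1
      exact add_right_cancel (hF (φ.mem_unique h1 (ha j).2))
    rw [finsum_mem_range he, finsum_eq_sum_of_fintype]
    simp only [weight_eq_of_arrow φ (hne _) (ha _), Finset.sum_sub_distrib]
    classical
    exact sub_eq_zero.2 (Equiv.sum_comp (Equiv.addRight (1 : Fin (n + 2)))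
      fun i => if F i = F' then (1 : ℤ) else 0)

theorem Balanced.sUnion [Finite D] {φ : G.EdgeInjective} {𝒞 : Set (Set G.Edge)}
    (hd : 𝒞.PairwiseDisjoint id) (h : ∀ c ∈ 𝒞, Balanced φ c) : Balanced φ (⋃₀ 𝒞) := by
  refine ⟨?_, fun F => ?_⟩
  · rintro e ⟨c, hc, he⟩
    exact (h c hc).1 e he
  · rw [finsum_mem_sUnion hd (Set.toFinite _) fun _ _ => Set.toFinite _]
    exact finsum_mem_eq_zero_of_forall_eq_zero fun c hc => (h c hc).2 F

theorem Balanced.sdiff [Finite D] {φ : G.EdgeInjective} {C C' : Set G.Edge}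
    (h : Balanced φ C) (h' : Balanced φ C') (hsub : C' ⊆ C) : Balanced φ (C \ C') := by
  refine ⟨fun e he => h.1 e he.1, fun F => ?_⟩
  have h1 := finsum_mem_add_sdiff (f := weight φ F) hsub (Set.toFinite C)
  rwa [h.2 F, h'.2 F, zero_add] at h1

theorem periodicPts_nonempty {α : Type*} [Finite α] [Nonempty α] (f : α → α) :
    (Function.periodicPts f).Nonempty := by
  obtain ⟨x⟩ := ‹Nonempty α›
  obtain ⟨m, n, hmn, h⟩ := Finite.exists_ne_map_eq_of_infinite fun n : ℕ => f^[n] x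
  wlog hlt : m < n generalizing m n
  · exact this n m hmn.symm h.symm (by omega)
  refine ⟨f^[m] x, Function.mk_mem_periodicPts (n := n - m) (by omega) ?_⟩
  change f^[n - m] (f^[m] x) = f^[m] x
  rw [← Function.iterate_add_apply, Nat.sub_add_cancel hlt.le]
  exact h.symm

theorem exists_arrow (hcov : ∀ (φ : G.EdgeInjective) e, ∃ F, e ∈ φ.1 F)
    {φ : G.EdgeInjective} {e : G.Edge} {F : G.BoundedFace} (hF : G.OnFace e F.1) (hn : e ∉ φ.1 F) :
    ∃ F', F ≠ F' ∧ Arrow φ e F F' := by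
  obtain ⟨F', hF'⟩ := hcov φ e
  have hne : F ≠ F' := by rintro rfl; exact hn hF'
  exact ⟨F', hne, Or.inl ⟨hne, hF, φ.onFace hF'⟩, hF'⟩

theorem Balanced.exists_out [Finite D] {φ : G.EdgeInjective} {C : Set G.Edge} (h : Balanced φ C)
    {e : G.Edge} (he : e ∈ C) {F : G.BoundedFace} (hF : e ∈ φ.1 F) :
    ∃ e' ∈ C, G.OnFace e' F.1 ∧ e' ∉ φ.1 F := by
  classical
  by_contra! hno
  have : Fintype G.Edge := Fintype.ofFinite _
  have h1 := h.2 F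
  have hnn : ∀ e' ∈ C, weight φ F e' = if e' ∈ φ.1 F then 1 else 0 := fun e' he' => by
    have := hno e' he'
    by_cases h2 : e' ∈ φ.1 F <;> simp [weight, h2]
    exact fun h3 => h2 (this h3)
  rw [finsum_mem_def, finsum_eq_sum_of_fintype, Finset.sum_eq_zero_iff_of_nonneg] at h1
  · have h2 := h1 e (Finset.mem_univ e)
    rw [Set.indicator_of_mem he, hnn e he, if_pos hF] at h2
    exact one_ne_zero h2
  · intro e' _
    refine Set.indicator_nonneg (fun x hx => ?_) e'
    rw [hnn x hx]
    split_ifs <;> simp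

/-- By balance, a face entered by an edge of `C` is also left by one. Choosing an outgoing edge at
each such face defines a self-map of a finite set; the orbit of a periodic point over one minimal
period is a simple cycle. -/
theorem Balanced.exists_isDirectedCycle [Finite D]
    (hcov : ∀ (φ : G.EdgeInjective) e, ∃ F, e ∈ φ.1 F)
    {φ : G.EdgeInjective} {C : Set G.Edge} (h : Balanced φ C) (hne : C.Nonempty) :
    ∃ c ⊆ C, IsDirectedCycle φ c := by
  let P := {F : G.BoundedFace // ∃ e ∈ C, G.OnFace e F.1 ∧ e ∉ φ.1 F}
  have hP : Nonempty P := by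
    obtain ⟨e, he⟩ := hne
    obtain ⟨F, hF⟩ := hcov φ e
    exact ⟨⟨F, h.exists_out he hF⟩⟩
  have hstep : ∀ F : P, ∃ (e : G.Edge) (F' : P), e ∈ C ∧ F.1 ≠ F'.1 ∧ Arrow φ e F.1 F'.1 := by
    rintro ⟨F, e, he, hF, hn⟩
    obtain ⟨F', hne', ha⟩ := exists_arrow hcov hF hn
    exact ⟨e, ⟨F', h.exists_out he ha.2⟩, he, hne', ha⟩
  choose ed s hed hs ha using hstep
  obtain ⟨x, hx⟩ := periodicPts_nonempty s
  have hpos := Function.minimalPeriod_pos_of_mem_periodicPts hx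
  -- Balanced sets contain no loops, so the cycle has length at least two.
  have hone : Function.minimalPeriod s x ≠ 1 := fun h1 => by
    have h2 := Function.isPeriodicPt_minimalPeriod s x
    rw [h1] at h2
    have h3 : s x = x := h2
    exact hs x (congrArg Subtype.val h3.symm)
  obtain ⟨n, hn⟩ : ∃ n, Function.minimalPeriod s x = n + 2 :=
    ⟨Function.minimalPeriod s x - 2, by omega⟩
  refine ⟨Set.range fun i : Fin (n + 2) => ed (s^[i.val] x), ?_, n, fun i => (s^[i.val] x).1,
    _, fun i j hij => ?_, fun i => ?_, rfl⟩
  · rintro _ ⟨i, rfl⟩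
    exact hed _
  · have h1 : s^[i.val] x = s^[j.val] x := Subtype.ext hij
    have h2 := Function.iterate_injOn_Iio_minimalPeriod (f := s) (x := x)
    rw [hn] at h2
    exact Fin.ext (h2 i.2 j.2 h1)
  · have h1 : s^[(i + 1).val] x = s (s^[i.val] x) := by
      rw [← Function.iterate_succ_apply' s i.val x,
        ← Function.iterate_mod_minimalPeriod_eq (n := i.val.succ), hn, Fin.val_add]
      simp
    simp only [h1]
    exact ha _

theorem Balanced.exists_eq_sUnion [Finite D]
    (hcov : ∀ (φ : G.EdgeInjective) e, ∃ F, e ∈ φ.1 F)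
    {φ : G.EdgeInjective} (n : ℕ) : ∀ C : Set G.Edge, C.ncard = n → Balanced φ C →
      ∃ 𝒞 : Set (Set G.Edge), (∀ c ∈ 𝒞, IsDirectedCycle φ c) ∧ 𝒞.PairwiseDisjoint id ∧
        C = ⋃₀ 𝒞 := by
  induction n using Nat.strong_induction_on with
  | _ n ih =>
  intro C hn hC
  rcases C.eq_empty_or_nonempty with rfl | hne
  · exact ⟨∅, by simp, by simp, by simp⟩
  obtain ⟨c, hsub, hc⟩ := hC.exists_isDirectedCycle hcov hne
  have hlt : (C \ c).ncard < n := by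
    rw [← hn]
    obtain ⟨e, he⟩ := hc.nonempty
    exact Set.ncard_lt_ncard ⟨Set.sdiff_subset, fun h => (h (hsub he)).2 he⟩ (Set.toFinite _)
  obtain ⟨𝒞, h1, h2, h3⟩ := ih _ hlt _ rfl (hC.sdiff hc.balanced hsub)
  refine ⟨insert c 𝒞, ?_, ?_, ?_⟩
  · rintro c' (rfl | hc')
    · exact hc
    · exact h1 c' hc'
  · refine h2.insert fun c' hc' _ => ?_
    have : c' ⊆ C \ c := h3 ▸ Set.subset_sUnion_of_mem hc'
    exact Set.disjoint_left.2 fun e he he' => (this he').2 he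
  · rw [Set.sUnion_insert, ← h3, Set.union_sdiff_cancel hsub]

theorem isGenDirectedCycle_iff [Finite D] (hcov : ∀ (φ : G.EdgeInjective) e, ∃ F, e ∈ φ.1 F)
    {φ : G.EdgeInjective} {C : Set G.Edge} :
    IsGenDirectedCycle φ C ↔ Balanced φ C ∧ C.Nonempty := by
  constructor
  · rintro ⟨𝒞, ⟨c, hc⟩, h1, h2, rfl⟩
    refine ⟨Balanced.sUnion h2 fun c hc => (h1 c hc).balanced, ?_⟩
    obtain ⟨e, he⟩ := (h1 c hc).nonempty
    exact ⟨e, c, hc, he⟩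
  · rintro ⟨hC, e, he⟩
    obtain ⟨𝒞, h1, h2, rfl⟩ := Balanced.exists_eq_sUnion hcov _ C rfl hC
    obtain ⟨c, hc, -⟩ := he
    exact ⟨𝒞, ⟨c, hc⟩, h1, h2, rfl⟩

/-- Any two edge-injective functions are related by reversing simple directed cycles. -/
theorem reflTransGen_reverses [Finite D] (hcov : ∀ (φ : G.EdgeInjective) e, ∃ F, e ∈ φ.1 F)
    (φ : G.EdgeInjective) (n : ℕ) : ∀ ψ : G.EdgeInjective, (diff ψ φ).ncard = n →
      Relation.ReflTransGen (fun ψ ψ' : G.EdgeInjective =>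
        ∃ C : Set G.Edge, IsDirectedCycle ψ C ∧ Reverses C ψ ψ') ψ φ := by
  induction n using Nat.strong_induction_on with
  | _ n ih =>
  intro ψ hn
  rcases (diff ψ φ).eq_empty_or_nonempty with h0 | hne
  · rw [eq_of_diff_eq_empty hcov h0]
  obtain ⟨c, hsub, hc⟩ := (balanced_diff hcov ψ φ).exists_isDirectedCycle hcov hne
  obtain ⟨ψ', hψ'⟩ := hc.balanced.exists_isFlip hcov
  -- On `c` the flip makes `ψ'` agree with `φ`; elsewhere nothing changes.
  have hsub' : diff ψ' φ ⊆ diff ψ φ \ c := by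
    rintro e ⟨F, h1, h2⟩
    rcases (hψ' F e).1 h1 with ⟨h3, h4, h5⟩ | ⟨h3, h4⟩
    · rcases not_or.1 (fun h => h2 ((isFlip_diff hcov ψ φ F e).2 h)) with ⟨h6, -⟩
      exact absurd ⟨hsub h3, h4, h5⟩ h6
    · exact ⟨⟨F, h4, h2⟩, h3⟩
  have hlt : (diff ψ' φ).ncard < n := by
    rw [← hn]
    obtain ⟨e, he⟩ := hc.nonempty
    exact Set.ncard_lt_ncard ⟨hsub'.trans Set.sdiff_subset, fun h => (hsub' (h (hsub he))).2 he⟩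
      (Set.toFinite _)
  exact Relation.ReflTransGen.head ⟨c, hc, hψ'.reverses_of_inner hcov hc.balanced.1⟩
    (ih _ hlt ψ' rfl)

/-- The edge-injective functions other than `φ` correspond to the generalized directed cycles. -/
theorem card_edgeInjective [Finite D] (hcov : ∀ (φ : G.EdgeInjective) e, ∃ F, e ∈ φ.1 F)
    (φ : G.EdgeInjective) :
    Nat.card G.EdgeInjective = Nat.card {C : Set G.Edge // IsGenDirectedCycle φ C} + 1 := by
  classical
  have : Finite G.EdgeInjective := inferInstance
  rw [← Nat.card_congr (Equiv.optionSubtypeNe φ), Finite.card_option]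
  congr 1
  refine Nat.card_congr (Equiv.ofBijective (fun ψ => ⟨diff φ ψ.1, (isGenDirectedCycle_iff hcov).2
    ⟨balanced_diff hcov φ ψ.1, ?_⟩⟩) ⟨fun ψ ψ' h => ?_, fun C => ?_⟩)
  · rw [Set.nonempty_iff_ne_empty]
    exact fun h => ψ.2 (eq_of_diff_eq_empty hcov h).symm
  · have h1 : diff φ ψ.1 = diff φ ψ'.1 := congrArg Subtype.val h
    have h2 := isFlip_diff hcov φ ψ'.1
    rw [← h1] at h2
    exact Subtype.ext ((isFlip_diff hcov φ ψ.1).unique h2)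
  · obtain ⟨hC, hne⟩ := (isGenDirectedCycle_iff hcov).1 C.2
    obtain ⟨ψ, hψ⟩ := hC.exists_isFlip hcov
    have hd := hψ.diff_eq hcov
    refine ⟨⟨ψ, ?_⟩, Subtype.ext hd⟩
    rintro rfl
    obtain ⟨e, he⟩ := hne
    rw [← hd] at he
    obtain ⟨F, h1, h2⟩ := he
    exact h2 h1

end Cycles

end PlaneGraph

namespace PlaneGraph

/-! ### Orientations of the modified dual as functions on darts. -/

section Darts

variable {D : Type*} {G : PlaneGraph D}

variable (G) in
/-- The edge of the dart is shared by two bounded faces. -/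
def NonLoop (d : D) : Prop := G.left d ≠ G.outer ∧ G.right d ≠ G.outer ∧ G.left d ≠ G.right d

/-- In the orientation of the modified dual, the edge of `d` is directed to the face on the left of
`d`. -/
def Into (φ : G.EdgeInjective) (d : D) : Prop :=
  ∃ h : G.left d ≠ G.outer, G.edge d ∈ φ.1 ⟨G.left d, h⟩

/-- The indicator function of `Into φ`. -/
noncomputable def into (φ : G.EdgeInjective) (d : D) : ℤ :=
  open Classical in if Into φ d then 1 else 0

theorem nonLoop_rev {d : D} : G.NonLoop (G.rev d) ↔ G.NonLoop d := by
  unfold NonLoop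
  rw [left_rev, right_rev]
  exact ⟨fun h => ⟨h.2.1, h.1, h.2.2.symm⟩, fun h => ⟨h.2.1, h.1, h.2.2.symm⟩⟩

theorem onFace_left (d : D) : G.OnFace (G.edge d) (G.left d) := ⟨d, rfl, rfl⟩

theorem onFace_right (d : D) : G.OnFace (G.edge d) (G.right d) := ⟨G.rev d, G.edge_rev d, rfl⟩

theorem inner_edge_iff {d : D} : Inner (G.edge d) ↔ G.NonLoop d := by
  constructor
  · rintro ⟨⟨F, h1⟩, ⟨F', h2⟩, hne, h3, h4⟩
    have hne' : F ≠ F' := fun h => hne (Subtype.ext h)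
    unfold NonLoop
    rcases onFace_edge_iff.1 h3 with rfl | rfl <;> rcases onFace_edge_iff.1 h4 with rfl | rfl
    · exact absurd rfl hne'
    · exact ⟨h1, h2, hne'⟩
    · exact ⟨h2, h1, hne'.symm⟩
    · exact absurd rfl hne'
  · rintro ⟨h1, h2, h3⟩
    exact ⟨⟨_, h1⟩, ⟨_, h2⟩, fun h => h3 (congrArg Subtype.val h), onFace_left d, onFace_right d⟩

theorem into_iff (φ : G.EdgeInjective) {d : D} {F : G.BoundedFace} (h : G.left d = F.1) :
    Into φ d ↔ G.edge d ∈ φ.1 F := by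
  obtain ⟨F, hF⟩ := F
  obtain rfl : G.left d = F := h
  exact ⟨fun ⟨_, h⟩ => h, fun h => ⟨hF, h⟩⟩

theorem into_rev_iff (φ : G.EdgeInjective) {d : D} {F : G.BoundedFace} (h : G.right d = F.1) :
    Into φ (G.rev d) ↔ G.edge d ∈ φ.1 F := by
  rw [into_iff φ (d := G.rev d) (F := F) h, edge_rev]

theorem into_rev (hcov : ∀ (φ : G.EdgeInjective) e, ∃ F, e ∈ φ.1 F) (φ : G.EdgeInjective) {d : D}
    (hd : G.NonLoop d) : Into φ (G.rev d) ↔ ¬ Into φ d := by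
  obtain ⟨h1, h2, h3⟩ := hd
  rw [into_iff φ (F := ⟨_, h1⟩) rfl, into_rev_iff φ (F := ⟨_, h2⟩) rfl]
  constructor
  · exact fun h h' => h3 (congrArg Subtype.val (φ.mem_unique h' h))
  · intro h
    obtain ⟨F, hF⟩ := hcov φ (G.edge d)
    rcases onFace_edge_iff.1 (φ.onFace hF) with h4 | h4
    · have : F = ⟨_, h1⟩ := Subtype.ext h4.symm
      exact absurd (this ▸ hF) h
    · have : F = ⟨_, h2⟩ := Subtype.ext h4.symm
      exact this ▸ hF

theorem eq_of_edge_eq {d d' : D} (hd : G.NonLoop d) (h : G.left d = G.left d')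
    (he : G.edge d = G.edge d') : d = d' := by
  rcases G.edge_eq_iff.1 he with h1 | rfl
  · exact h1
  · exact absurd (by rw [right_rev]; exact h) hd.2.2

/-- Every loop at `F` must belong to `φ(F)`. Hence the number of incoming non-loops at `F` does not
depend on `φ`, and this is what makes differences sum to zero around faces. -/
theorem card_into [Fintype D] (hcov : ∀ (φ : G.EdgeInjective) e, ∃ F, e ∈ φ.1 F)
    (φ : G.EdgeInjective) (F : G.BoundedFace) :
    (open Classical in (Finset.univ.filter fun d =>
      G.left d = F.1 ∧ G.NonLoop d ∧ Into φ d).card) +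
      {e | ¬ Inner e ∧ G.OnFace e F.1}.ncard = 3 := by
  classical
  have h1 : (Finset.univ.filter fun d => G.left d = F.1 ∧ G.NonLoop d ∧ Into φ d).card =
      ((φ.1 F).filter fun e => Inner e).card := by
    rw [← Finset.card_image_of_injOn (f := G.edge)]
    · congr 1
      ext e
      simp only [Finset.mem_image, Finset.mem_filter, Finset.mem_univ, true_and]
      constructor
      · rintro ⟨d, ⟨h1, h2, h3⟩, rfl⟩
        exact ⟨(into_iff φ h1).1 h3, inner_edge_iff.2 h2⟩
      · rintro ⟨he, hi⟩
        obtain ⟨d, rfl, hd⟩ := φ.onFace he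
        exact ⟨d, ⟨hd, inner_edge_iff.1 hi, (into_iff φ hd).2 he⟩, rfl⟩
    · intro d hd d' hd' he
      simp only [Finset.coe_filter, Finset.mem_univ, true_and, Set.mem_ofPred_eq] at hd hd'
      exact eq_of_edge_eq hd.2.1 (hd.1.trans hd'.1.symm) he
  have h2 : {e | ¬ Inner e ∧ G.OnFace e F.1} =
      (((φ.1 F).filter fun e => ¬ Inner e : Finset G.Edge) : Set G.Edge) := by
    ext e
    simp only [Set.mem_ofPred_eq, Finset.coe_filter]
    constructor
    · rintro ⟨hi, he⟩
      obtain ⟨F', hF'⟩ := hcov φ e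
      have : F = F' := by
        by_contra hne
        exact hi ⟨F, F', hne, he, φ.onFace hF'⟩
      exact ⟨this ▸ hF', hi⟩
    · exact fun ⟨he, hi⟩ => ⟨hi, φ.onFace he⟩
  rw [h1, h2, Set.ncard_coe_finset, Finset.card_filter_add_card_filter_not, φ.2.1 F]

end Darts

/-! ### Height functions and the existence of a directed face cycle. -/

section Potential

variable {D : Type*} {G : PlaneGraph D}

/-- An integral height function for the difference of two orientations, vanishing at the
unbounded face. -/
def IsPotential (φ ψ : G.EdgeInjective) (p : G.Vertex → ℤ) : Prop :=
  (∀ d, G.NonLoop d → into φ d - into ψ d = p (G.tail (G.rev d)) - p (G.tail d)) ∧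
    ∀ v, ¬ Interior v → p v = 0

theorem IsPotential.neg {φ ψ : G.EdgeInjective} {p : G.Vertex → ℤ} (h : IsPotential φ ψ p) :
    IsPotential ψ φ (-p) := by
  refine ⟨fun d hd => ?_, fun v hv => ?_⟩
  · have := h.1 d hd
    simp only [Pi.neg_apply]
    omega
  · simp [h.2 v hv]

theorem into_of_into {φ : G.EdgeInjective} {d : D} (h : Into φ d) : into φ d = 1 := by
  simp [into, h]

theorem into_of_not_into {φ : G.EdgeInjective} {d : D} (h : ¬ Into φ d) : into φ d = 0 := by
  simp [into, h]

theorem into_rev_eq (hcov : ∀ (φ : G.EdgeInjective) e, ∃ F, e ∈ φ.1 F) (φ : G.EdgeInjective)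
    {d : D} (hd : G.NonLoop d) : into φ (G.rev d) = 1 - into φ d := by
  by_cases h : Into φ d
  · rw [into_of_into h, into_of_not_into fun h' => (into_rev hcov φ hd).1 h' h]
    rfl
  · rw [into_of_not_into h, into_of_into ((into_rev hcov φ hd).2 h)]
    rfl

theorem exists_isPotential [Finite D] (hcov : ∀ (φ : G.EdgeInjective) e, ∃ F, e ∈ φ.1 F)
    (φ ψ : G.EdgeInjective) : ∃ p, IsPotential φ ψ p := by
  classical
  have : Fintype D := Fintype.ofFinite D
  have : Fintype G.Face := Fintype.ofFinite _
  let k : D → ℤ := fun d => if G.NonLoop d then into φ d - into ψ d else 0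
  let c : D → ℚ := fun d => k d
  have hc : c ∈ G.anti := by
    intro d
    simp only [c, k, nonLoop_rev]
    by_cases hd : G.NonLoop d
    · simp only [hd, if_true, into_rev_eq hcov φ hd, into_rev_eq hcov ψ hd]
      push_cast
      ring
    · simp [hd]
  have hface : ∀ F : G.Face, ∑ d with G.left d = F, k d = 0 := by
    intro F
    by_cases hF : F = G.outer
    · refine Finset.sum_eq_zero fun d hd => if_neg fun h => h.1 ?_
      rw [(Finset.mem_filter.1 hd).2, hF]
    · have key : ∀ χ : G.EdgeInjective, ∑ d with G.left d = F,
          (if G.NonLoop d then into χ d else 0) =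
          (3 - {e | ¬ Inner e ∧ G.OnFace e F}.ncard : ℤ) := by
        intro χ
        have h1 := card_into hcov χ ⟨F, hF⟩
        have h2 : ∑ d with G.left d = F, (if G.NonLoop d then into χ d else 0) =
            ((Finset.univ.filter fun d => G.left d = F ∧ G.NonLoop d ∧ Into χ d).card : ℤ) := by
          rw [Finset.card_filter, Finset.sum_filter]
          push_cast
          refine Finset.sum_congr rfl fun d _ => ?_
          by_cases h3 : G.left d = F <;> by_cases h4 : G.NonLoop d <;> by_cases h5 : Into χ d <;>
            simp [h3, h4, h5, into]
        rw [h2, ← Nat.cast_ofNat, ← h1]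
        push_cast
        simp
      have h3 : ∀ d, k d = (if G.NonLoop d then into φ d else 0) -
          (if G.NonLoop d then into ψ d else 0) := by
        intro d
        by_cases hd : G.NonLoop d <;> simp [k, hd]
      simp only [h3, Finset.sum_sub_distrib, key, sub_self]
  obtain ⟨p, hp⟩ := G.exists_eq_vcob hc fun g => by
    rw [← Finset.sum_fiberwise Finset.univ G.left]
    refine Finset.sum_eq_zero fun F _ => ?_
    have : ∑ d with G.left d = F, g (G.left d) * c d = g F * ((∑ d with G.left d = F, k d : ℤ) : ℚ) := by
      push_cast
      rw [Finset.mul_sum]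
      exact Finset.sum_congr rfl fun d hd => by rw [(Finset.mem_filter.1 hd).2]
    rw [this, hface]
    simp
  have hp' : ∀ d, p (G.tail (G.rev d)) = p (G.tail d) + k d := fun d => by
    have h : (k d : ℚ) = p (G.tail (G.rev d)) - p (G.tail d) := congrFun hp d
    rw [h]
    ring
  obtain ⟨d0, hd0⟩ : ∃ d0, G.left d0 = G.outer := ⟨G.outer.out, Quotient.out_eq _⟩
  -- All increments `k d` are integers, so taking floors preserves them. Normalising at `d0` kills
  -- the height along the whole unbounded face, whose darts have `k d = 0`.
  refine ⟨fun v => ⌊p v - p (G.tail d0)⌋, fun d hd => ?_, fun v hv => ?_⟩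
  · have h1 : p (G.tail (G.rev d)) - p (G.tail d0) = p (G.tail d) - p (G.tail d0) + k d := by
      rw [hp']
      ring
    beta_reduce
    rw [h1, Int.floor_add_intCast]
    simp [k, hd]
  · unfold Interior at hv
    push Not at hv
    obtain ⟨d, rfl, hd⟩ := hv
    have : p (G.tail d) = p (G.tail d0) :=
      G.eq_of_left_eq (fun d => p (G.tail d)) G.outer (fun d hd => by
        have : k d = 0 := if_neg fun h => h.1 hd
        rw [tail_face, hp', this]
        simp) hd hd0
    simp [this]

/-- The darts `f x` form closed walks in $G$, with successor `σ`, whose edges all point to the left.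
The net traversal count `n` has zero sum at each vertex, so it is the coboundary of a winding number
`g` on the faces. -/
theorem not_injective_walk [Finite D] (hcov : ∀ (φ : G.EdgeInjective) e, ∃ F, e ∈ φ.1 F)
    (hcon : G.NoProperContractible) (φ : G.EdgeInjective) {α : Type*} [Finite α] [Nonempty α]
    (f : α → D) (σ : Equiv.Perm α) (hσ : ∀ x, G.tail (G.rev (f x)) = G.tail (f (σ x)))
    (hnl : ∀ x, G.NonLoop (f x)) (hin : ∀ x, Into φ (f x)) : False := by
  classical
  have : Fintype D := Fintype.ofFinite D
  have : Fintype α := Fintype.ofFinite α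
  let N : D → ℚ := fun d => ∑ x, if d = f x then 1 else 0
  have hN0 : ∀ d, 0 ≤ N d := fun d => Finset.sum_nonneg fun x _ => by split_ifs <;> simp
  have hN1 : ∀ d, (∀ x, d ≠ f x) → N d = 0 := fun d hd =>
    Finset.sum_eq_zero fun x _ => if_neg (hd x)
  have hN2 : ∀ x, 0 < N (f x) := fun x =>
    Finset.sum_pos' (fun y _ => by split_ifs <;> simp) ⟨x, Finset.mem_univ x, by simp⟩
  let n : D → ℚ := fun d => N d - N (G.rev d)
  have hn : n ∈ G.anti := fun d => by simp [n, G.rev_rev]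
  have hpair : ∀ q : D → ℚ, ∑ d, q d * N d = ∑ x, q (f x) := by
    intro q
    simp only [N, Finset.mul_sum, mul_ite, mul_one, mul_zero]
    rw [Finset.sum_comm]
    simp
  obtain ⟨g, hg⟩ := G.exists_eq_fcob hn fun p => by
    simp only [n, mul_sub, Finset.sum_sub_distrib]
    rw [hpair, ← Equiv.sum_comp G.rev (fun d => p (G.tail d) * N (G.rev d))]
    simp only [G.rev_rev]
    rw [hpair (fun d => p (G.tail (G.rev d)))]
    simp only [hσ]
    rw [Equiv.sum_comp σ fun x => p (G.tail (f x)), sub_self]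
  have hg' : ∀ d, n d = g (G.left d) - g (G.right d) := fun d => congrFun hg d
  have hpos : ∀ d, g (G.right d) < g (G.left d) → ∃ x, d = f x := by
    intro d hd
    by_contra! hno
    have h1 := hg' d
    have h2 := hN0 (G.rev d)
    simp only [n, hN1 d hno] at h1
    linarith
  obtain ⟨x0⟩ := ‹Nonempty α›
  have hx0 : g (G.right (f x0)) < g (G.left (f x0)) := by
    -- The reverse of a walk dart would point the wrong way, so it is never traversed; nothing
    -- cancels and `g` is not constant.
    have h1 := hg' (f x0)
    have h2 : N (G.rev (f x0)) = 0 := hN1 _ fun y hy =>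
      (into_rev hcov φ (hnl x0)).1 (hy ▸ hin y) (hin x0)
    have h3 := hN2 x0
    simp only [n, h2] at h1
    linarith
  have : Nonempty G.Face := ⟨G.outer⟩
  obtain ⟨F0, hF0⟩ := Finite.exists_max g
  let S : Set G.Face := {F | g F = g F0}
  have hS : ∀ d, G.left d ∈ S → G.right d ∉ S → ∃ x, d = f x := by
    intro d h1 h2
    refine hpos d (lt_of_le_of_ne ?_ ?_)
    · rw [show g (G.left d) = g F0 from h1]
      exact hF0 _
    · intro h3
      exact h2 (h3.trans h1)
  obtain ⟨d, hd1, hd2⟩ : ∃ d, G.left d ∈ S ∧ G.right d ∉ S := by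
    by_contra! hno
    have h1 : ∀ d, (G.left d ∈ S) = (G.right d ∈ S) := fun d =>
      propext ⟨hno d, fun h => by simpa [right_rev] using hno (G.rev d) h⟩
    have h2 : ∀ F, F ∈ S := fun F => by
      rw [G.face_eq_of_invariant (fun F => F ∈ S) h1 F F0]
      rfl
    rw [show g (G.right (f x0)) = g F0 from h2 _, show g (G.left (f x0)) = g F0 from h2 _] at hx0
    exact lt_irrefl _ hx0
  obtain ⟨x, rfl⟩ := hS d hd1 hd2
  let Sb : Set G.BoundedFace := {F | F.1 ∈ S}
  refine hcon Sb ⟨⟨_, (hnl x).1⟩, hd1⟩ (fun h => ?_) ?_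
  · have : (⟨_, (hnl x).2.1⟩ : G.BoundedFace) ∈ Sb := h ▸ Set.mem_univ _
    exact hd2 this
  · have : Fintype G.BoundedFace := Fintype.ofFinite _
    -- An edge between `Sb` and a bounded face outside has its larger `g` on the side of `Sb`, so it
    -- is traversed with `Sb` on its left and is owned there. All edges of `Sb` are thus owned
    -- within `Sb`, giving $e_S\le 3f_S$.
    have hsub : G.edgesOf Sb ⊆ (Sb.toFinset.biUnion φ.1 : Finset G.Edge) := by
      rintro e ⟨F, hF, d, rfl, hd⟩
      obtain ⟨F1, h1⟩ := hcov φ (G.edge d)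
      simp only [Finset.coe_biUnion, Set.mem_iUnion, Finset.mem_coe, Set.mem_toFinset]
      by_cases h2 : F1 ∈ Sb
      · exact ⟨F1, h2, h1⟩
      have h3 : G.right d = F1.1 := by
        rcases onFace_edge_iff.1 (φ.onFace h1) with h | h
        · exact absurd (show F1.1 ∈ S by rw [← h, hd]; exact hF) h2
        · exact h
      obtain ⟨y, rfl⟩ := hS d (by rw [hd]; exact hF) (by rw [h3]; exact h2)
      exact ⟨F, hF, (into_iff φ hd).1 (hin y)⟩
    have h1 := Set.ncard_le_ncard hsub (Set.toFinite _)
    rw [Set.ncard_coe_finset] at h1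
    have h2 := Finset.card_biUnion_le_card_mul Sb.toFinset φ.1 3 fun F _ => (φ.2.1 F).le
    rw [← Set.ncard_eq_toFinset_card'] at h2
    unfold Contractible
    omega

/-- If every vertex of maximal height had an outgoing dart with `Into φ`, following such darts would
stay at maximal height and eventually close up, against `not_injective_walk`. -/
theorem IsPotential.exists_sink [Finite D] (hcov : ∀ (φ : G.EdgeInjective) e, ∃ F, e ∈ φ.1 F)
    (hcon : G.NoProperContractible) {φ ψ : G.EdgeInjective} {p : G.Vertex → ℤ}
    (h : IsPotential φ ψ p) (hpos : ∃ v, 0 < p v) :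
    ∃ v, 0 < p v ∧ ∀ d, G.tail d = v → G.NonLoop d → ¬ Into φ d := by
  obtain ⟨v1, hv1⟩ := hpos
  have : Nonempty G.Vertex := ⟨v1⟩
  obtain ⟨v0, hv0⟩ := Finite.exists_max p
  by_contra! hno
  let T := {v // p v = p v0}
  have hstep : ∀ v : T, ∃ (d : D) (w : T), G.tail d = v.1 ∧ G.NonLoop d ∧ Into φ d ∧
      G.tail (G.rev d) = w.1 := by
    rintro ⟨v, hv⟩
    obtain ⟨d, h1, h2, h3⟩ := hno v (hv ▸ hv1.trans_le (hv0 v1))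
    refine ⟨d, ⟨G.tail (G.rev d), ?_⟩, h1, h2, h3, rfl⟩
    have h4 := h.1 d h2
    -- The height changes by $1-$ `into ψ d` $\ge 0$ along `d`, so by maximality it stays the same.
    rw [into_of_into h3, h1] at h4
    have h5 := hv0 (G.tail (G.rev d))
    have h6 : into ψ d ≤ 1 := by unfold into; split_ifs <;> simp
    omega
  choose f s h1 h2 h3 h4 using hstep
  have : Nonempty T := ⟨⟨v0, rfl⟩⟩
  have : Nonempty (Function.periodicPts s) := (periodicPts_nonempty s).to_subtype
  -- On its periodic points the successor map is a permutation.
  let σ : Equiv.Perm (Function.periodicPts s) := (Function.bijOn_periodicPts s).equiv s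
  refine not_injective_walk hcov hcon φ (fun x : Function.periodicPts s => f x.1) σ
    (fun x => ?_) (fun x => h2 _) (fun x => h3 _)
  rw [h4, h1]
  rfl

end Potential

/-! ### Reversing face cycles and descent on the height. -/

section VertexFlips

variable {D : Type*} {G : PlaneGraph D}

variable (G) in
/-- The non-loops among the edges of the modified dual around the vertex `v`. -/
def nonLoopsAt (v : G.Vertex) : Set G.Edge := G.edge '' {d | G.tail d = v ∧ G.NonLoop d}

theorem nonLoopsAt_eq (v : G.Vertex) : G.nonLoopsAt v = {e | e ∈ faceCycle v ∧ Inner e} := by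
  ext e
  constructor
  · rintro ⟨d, ⟨h1, h2⟩, rfl⟩
    exact ⟨⟨d, h1, rfl⟩, inner_edge_iff.2 h2⟩
  · rintro ⟨⟨d, h1, rfl⟩, h2⟩
    exact ⟨d, ⟨h1, inner_edge_iff.1 h2⟩, rfl⟩

theorem right_ne_outer_of_interior {v : G.Vertex} (hv : Interior v) {d : D} (hd : G.tail d = v) :
    G.right d ≠ G.outer := by
  have h := hv (G.next⁻¹ d) (by rw [← hd, ← G.tail_next]; simp)
  rw [← right_next] at h
  simpa using h

theorem arrow_left_right (hcov : ∀ (φ : G.EdgeInjective) e, ∃ F, e ∈ φ.1 F) {φ : G.EdgeInjective}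
    {d : D} (hd : G.NonLoop d) (h : ¬ Into φ d) :
    Arrow φ (G.edge d) ⟨G.left d, hd.1⟩ ⟨G.right d, hd.2.1⟩ := by
  refine ⟨Or.inl ⟨fun h => hd.2.2 (congrArg Subtype.val h), onFace_left d, onFace_right d⟩, ?_⟩
  exact (into_rev_iff φ (F := ⟨_, hd.2.1⟩) rfl).1 ((into_rev hcov φ hd).2 h)

theorem isDirectedFaceCycle_of_not_into (hcov : ∀ (φ : G.EdgeInjective) e, ∃ F, e ∈ φ.1 F)
    {φ : G.EdgeInjective} {v : G.Vertex} (hv : Interior v)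
    (h : ∀ d, G.tail d = v → G.NonLoop d → ¬ Into φ d) : IsDirectedFaceCycle φ v := by
  refine ⟨hv, Or.inr fun d hd => ⟨hv d hd, right_ne_outer_of_interior hv hd, ?_⟩⟩
  -- An edge with the same face on both sides is a loop of the dual, so its arrow holds in either
  -- direction.
  by_cases hne : G.left d = G.right d
  · have hu : ∀ F : G.BoundedFace, G.OnFace (G.edge d) F.1 → F.1 = G.right d := by
      intro F hF
      rcases onFace_edge_iff.1 hF with h | h
      · rw [← h, hne]
      · exact h.symm
    refine ⟨Or.inr ⟨Subtype.ext hne, onFace_left d, fun F hF => Subtype.ext ?_⟩, ?_⟩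
    · exact (hu F hF).trans hne.symm
    · obtain ⟨F, hF⟩ := hcov φ (G.edge d)
      have : F = ⟨G.right d, right_ne_outer_of_interior hv hd⟩ :=
        Subtype.ext (hu F (φ.onFace hF))
      rwa [← this]
  · have hnl : G.NonLoop d := ⟨hv d hd, right_ne_outer_of_interior hv hd, hne⟩
    exact arrow_left_right hcov hnl (h d hd hnl)

/-- Every arrow around `v` goes from left to right, and rotation by `next` matches right faces with
left faces, so arrivals and departures at each `F` cancel. -/
theorem balanced_nonLoopsAt [Finite D] (hcov : ∀ (φ : G.EdgeInjective) e, ∃ F, e ∈ φ.1 F)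
    {φ : G.EdgeInjective} {v : G.Vertex} (hv : Interior v)
    (h : ∀ d, G.tail d = v → G.NonLoop d → ¬ Into φ d) : Balanced φ (G.nonLoopsAt v) := by
  classical
  have : Fintype D := Fintype.ofFinite D
  refine ⟨fun e he => ?_, fun F => ?_⟩
  · rw [nonLoopsAt_eq] at he
    exact he.2
  have hinj : Set.InjOn G.edge {d | G.tail d = v ∧ G.NonLoop d} := by
    rintro d ⟨h1, h2⟩ d' ⟨h3, h4⟩ he
    rcases G.edge_eq_iff.1 he with h5 | rfl
    · exact h5
    · exact absurd ((into_rev hcov φ h4).2 (h d' h3 h4)) (h _ h1 h2)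
  rw [nonLoopsAt, finsum_mem_image hinj, finsum_mem_def, finsum_eq_sum_of_fintype]
  have key : ∀ d, Set.indicator {d | G.tail d = v ∧ G.NonLoop d}
      (fun d => weight φ F (G.edge d)) d =
      (if G.tail d = v ∧ G.right d = F.1 then (1 : ℤ) else 0) -
        (if G.tail d = v ∧ G.left d = F.1 then 1 else 0) := by
    intro d
    by_cases hd : G.tail d = v
    · by_cases hnl : G.NonLoop d
      · rw [Set.indicator_of_mem (show d ∈ {d | G.tail d = v ∧ G.NonLoop d} from ⟨hd, hnl⟩),
          weight_eq_of_arrow φ _ (arrow_left_right hcov hnl (h d hd hnl))]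
        · simp only [Subtype.ext_iff, hd, true_and]
        · exact fun h => hnl.2.2 (congrArg Subtype.val h)
      · rw [Set.indicator_of_notMem fun h => hnl h.2]
        have : G.left d = G.right d := by
          by_contra hne
          exact hnl ⟨hv d hd, right_ne_outer_of_interior hv hd, hne⟩
        simp [this]
    · rw [Set.indicator_of_notMem fun h => hd h.1]
      simp [hd]
  simp only [key, Finset.sum_sub_distrib]
  rw [← Equiv.sum_comp G.next]
  simp only [tail_next, right_next, sub_self]

theorem mem_nonLoopsAt_iff {v : G.Vertex} {d : D} (hd : G.NonLoop d) :
    G.edge d ∈ G.nonLoopsAt v ↔ G.tail d = v ∨ G.tail (G.rev d) = v := by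
  constructor
  · rintro ⟨d', ⟨h1, -⟩, h3⟩
    rcases G.edge_eq_iff.1 h3 with rfl | rfl
    · exact Or.inl h1
    · exact Or.inr h1
  · rintro (h | h)
    · exact ⟨d, ⟨h, hd⟩, rfl⟩
    · exact ⟨G.rev d, ⟨h, nonLoop_rev.2 hd⟩, G.edge_rev d⟩

theorem IsFlip.into_of_mem {φ ψ : G.EdgeInjective} {C : Set G.Edge} (hf : IsFlip φ C ψ) {d : D}
    (hd : G.NonLoop d) (h : G.edge d ∈ C) : into ψ d = 1 - into φ d := by
  have h1 : Into ψ d ↔ ¬ Into φ d := by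
    rw [into_iff ψ (F := ⟨_, hd.1⟩) rfl, into_iff φ (F := ⟨_, hd.1⟩) rfl, hf]
    simp [h, onFace_left]
  by_cases h2 : Into φ d <;> simp [into, h1, h2]

theorem IsFlip.into_of_notMem {φ ψ : G.EdgeInjective} {C : Set G.Edge} (hf : IsFlip φ C ψ) {d : D}
    (hd : G.NonLoop d) (h : G.edge d ∉ C) : into ψ d = into φ d := by
  have h1 : Into ψ d ↔ Into φ d := by
    rw [into_iff ψ (F := ⟨_, hd.1⟩) rfl, into_iff φ (F := ⟨_, hd.1⟩) rfl, hf]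
    simp [h]
  by_cases h2 : Into φ d <;> simp [into, h1, h2]

theorem IsPotential.exists_step [Fintype G.Vertex] [Finite D]
    (hcov : ∀ (φ : G.EdgeInjective) e, ∃ F, e ∈ φ.1 F)
    (hcon : G.NoProperContractible) {φ ψ : G.EdgeInjective} {p : G.Vertex → ℤ}
    (h : IsPotential φ ψ p) (hpos : ∃ v, 0 < p v) :
    ∃ φ' p', G.flipGraph.Reachable φ φ' ∧ IsPotential φ' ψ p' ∧
      ∑ v, (p' v).natAbs < ∑ v, (p v).natAbs := by
  classical
  obtain ⟨v, hv, hs⟩ := h.exists_sink hcov hcon hpos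
  have hint : Interior v := by
    by_contra hn
    exact hv.ne' (h.2 v hn)
  obtain ⟨φ', hφ'⟩ := (balanced_nonLoopsAt hcov hint hs).exists_isFlip hcov
  refine ⟨φ', Function.update p v (p v - 1), ?_, ⟨fun d hd => ?_, fun w hw => ?_⟩, ?_⟩
  · by_cases hne : φ = φ'
    · rw [hne]
    refine SimpleGraph.Adj.reachable ((SimpleGraph.fromRel_adj _ _ _).2 ⟨hne, Or.inl ⟨v, ?_, ?_⟩⟩)
    · exact isDirectedFaceCycle_of_not_into hcov hint hs
    · exact IsFlip.reverses hcov (nonLoopsAt_eq v ▸ hφ')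
  · have h1 := h.1 d hd
    have h0 := into_rev_eq hcov φ hd
    by_cases ht : G.tail d = v <;> by_cases hh : G.tail (G.rev d) = v
    -- A loop of $G$ at `v` that is a non-loop of the dual would have one of its two darts `Into φ`,
    -- against the choice of `v`.
    · rw [into_of_not_into (hs _ ht hd), into_of_not_into (hs _ hh (nonLoop_rev.2 hd))] at h0
      simp at h0
    · rw [hφ'.into_of_mem hd ((mem_nonLoopsAt_iff hd).2 (Or.inl ht)), Function.update_of_ne hh, ht,
        Function.update_self]
      rw [into_of_not_into (hs _ ht hd), ht] at h1
      rw [into_of_not_into (hs _ ht hd)]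
      omega
    · rw [into_of_not_into (hs _ hh (nonLoop_rev.2 hd))] at h0
      rw [hφ'.into_of_mem hd ((mem_nonLoopsAt_iff hd).2 (Or.inr hh)), Function.update_of_ne ht, hh,
        Function.update_self]
      rw [hh] at h1
      omega
    · rw [hφ'.into_of_notMem hd (by rw [mem_nonLoopsAt_iff hd]; tauto), Function.update_of_ne ht,
        Function.update_of_ne hh, h1]
  · rw [Function.update_of_ne (by rintro rfl; exact hw hint)]
    exact h.2 w hw
  · refine Finset.sum_lt_sum (fun w _ => ?_) ⟨v, Finset.mem_univ v, ?_⟩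
    · by_cases hw : w = v
      · subst hw
        rw [Function.update_self]
        omega
      · rw [Function.update_of_ne hw]
    · rw [Function.update_self]
      omega

theorem IsPotential.eq_of_eq_zero (hcov : ∀ (φ : G.EdgeInjective) e, ∃ F, e ∈ φ.1 F)
    {φ ψ : G.EdgeInjective} {p : G.Vertex → ℤ} (h : IsPotential φ ψ p) (h0 : ∀ v, p v = 0) :
    φ = ψ := by
  refine eq_of_diff_eq_empty hcov (Set.eq_empty_iff_forall_notMem.2 fun e he => ?_)
  have hi := inner_of_mem_diff hcov he
  obtain ⟨F, h1, h2⟩ := he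
  obtain ⟨d, rfl, hd⟩ := φ.onFace h1
  have h3 := h.1 d (inner_edge_iff.1 hi)
  rw [h0, h0, into_of_into ((into_iff φ hd).2 h1),
    into_of_not_into fun h => h2 ((into_iff ψ hd).1 h)] at h3
  simp at h3

theorem reachable_of_isPotential [Fintype G.Vertex] [Finite D]
    (hcov : ∀ (φ : G.EdgeInjective) e, ∃ F, e ∈ φ.1 F) (hcon : G.NoProperContractible) (n : ℕ) :
    ∀ (φ ψ : G.EdgeInjective) (p : G.Vertex → ℤ), IsPotential φ ψ p →
      ∑ v, (p v).natAbs = n → G.flipGraph.Reachable φ ψ := by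
  induction n using Nat.strong_induction_on with
  | _ n ih =>
  intro φ ψ p hp hn
  by_cases hpos : ∃ v, 0 < p v
  · obtain ⟨φ', p', h1, h2, h3⟩ := hp.exists_step hcov hcon hpos
    exact h1.trans (ih _ (hn ▸ h3) φ' ψ p' h2 rfl)
  by_cases hneg : ∃ v, 0 < (-p) v
  · obtain ⟨ψ', p', h1, h2, h3⟩ := hp.neg.exists_step hcov hcon hneg
    simp only [Pi.neg_apply, Int.natAbs_neg] at h3
    exact ((h1.trans (ih _ (hn ▸ h3) ψ' φ p' h2 rfl))).symm
  · push Not at hpos hneg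
    have h0 : ∀ v, p v = 0 := fun v => le_antisymm (hpos v) (by simpa using hneg v)
    rw [hp.eq_of_eq_zero hcov h0]

end VertexFlips

end PlaneGraph

theorem mainTheorem11 {D : Type*} [Finite D] (G : PlaneGraph D)
    (hleaf : G.NoLeaves)
    (hcard : Nat.card G.Edge = 3 * Nat.card G.BoundedFace)
    (hcon : G.NoProperContractible) :
    -- reversing directed cycles
    (∀ φ φ' : G.EdgeInjective,
      Relation.ReflTransGen
        (fun ψ ψ' : G.EdgeInjective =>
          ∃ C : Set G.Edge, PlaneGraph.IsDirectedCycle ψ C ∧ PlaneGraph.Reverses C ψ ψ')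
        φ' φ) ∧
    -- reversing directed face cycles
    G.flipGraph.Connected ∧
    -- counting
    (∀ φ : G.EdgeInjective,
      Nat.card G.EdgeInjective =
        Nat.card {C : Set G.Edge // PlaneGraph.IsGenDirectedCycle φ C} + 1) ∧
    (∀ φ φ' : G.EdgeInjective,
      Nat.card {C : Set G.Edge // PlaneGraph.IsGenDirectedCycle φ C} =
        Nat.card {C : Set G.Edge // PlaneGraph.IsGenDirectedCycle φ' C}) := by
  have hcov : ∀ (φ : G.EdgeInjective) e, ∃ F, e ∈ φ.1 F := fun φ =>
    PlaneGraph.EdgeInjective.exists_mem hcard φ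
  have hvert : Fintype G.Vertex := Fintype.ofFinite _
  refine ⟨fun φ φ' => PlaneGraph.reflTransGen_reverses hcov φ _ φ' rfl, ?_,
    fun φ => PlaneGraph.card_edgeInjective hcov φ, fun φ φ' => ?_⟩
  · have hne := G.nonempty_edgeInjective hleaf hcard hcon
    refine (SimpleGraph.connected_iff _).2 ⟨fun φ ψ => ?_, hne⟩
    obtain ⟨p, hp⟩ := PlaneGraph.exists_isPotential hcov φ ψ
    exact PlaneGraph.reachable_of_isPotential hcov hcon _ φ ψ p hp rfl
  · have h1 := PlaneGraph.card_edgeInjective hcov φ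
    have h2 := PlaneGraph.card_edgeInjective hcov φ'
    omega
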